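/- Let $S^3=\{x=x^0+x^1\mathbf i+x^2\mathbf j+x^3\mathbf k\in\mathbb H:\ |x|=1\}$ be the Lie group of unit quaternions, and let $$\Theta^1=-x^1dx^0+x^0dx^1-x^3dx^2+x^2dx^3,\quad \Theta^2=-x^2dx^0+x^3dx^1+x^0dx^2-x^1dx^3,\quad \Theta^3=-x^3dx^0-x^2dx^1+x^1dx^2+x^0dx^3,$$ restricted to $S^3$. Let $K>1$, let $\sigma\in\{1,-1\}$, and put $$\tilde a=K\,\Theta^1\otimes\Theta^1+\Theta^2\otimes\Theta^2+\Theta^3\otimes\Theta^3,\qquad \tilde b=\sigma\sqrt{K-1}\,\Theta^1,$$ $$F(x,y)=\alpha+\beta,\qquad \alpha=\sqrt{\tilde a_x(y,y)},\quad \beta=\tilde b_x(y)\qquad (y\in T_xS^3).$$ In local coordinates $x^i$, with induced fibre coordinates $y^i$ and $y\neq 0$, set $$g_{ij}=\tfrac12(F^2)_{y^iy^j},\qquad G^i=\tfrac12\gamma^i_{jk}y^jy^k,\qquad \gamma^i_{jk}=g^{il}\,\tfrac12\Big(\frac{\partial g_{lj}}{\partial x^k}-\frac{\partial g_{jk}}{\partial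 x^l}+\frac{\partial g_{kl}}{\partial x^j}\Big),$$ and define the spray curvature by Berwald's formula $$K^i_{\ k}=2(G^i)_{x^k}-y^j(G^i)_{x^jy^k}-(G^i)_{y^j}(G^j)_{y^k}+2G^j(G^i)_{y^jy^k}.$$ With $K_{ik}=g_{ij}K^j_{\ k}$ and $g(U,W)=g_{ij}U^iW^j$, the flag curvature of a flag with flagpole $y\ne0$ and transverse edge $V$ (that is, $y,V$ linearly independent) is $$K(y,V)=\frac{V^iK_{ik}V^k}{g(y,y)\,g(V,V)-g(y,V)^2}.$$ Then: 1. $\tilde a$ is a smooth right-invariant Riemannian metric on $S^3$, and $\tilde b$ is a smooth $1$-form whose $\tilde a$-norm $\|\tilde b\|=\sqrt{\tilde a^{ij}\tilde b_i\tilde b_j}$ is constant, equal to $\sqrt{1-1/K}<1$. 2. The Randers metric $F$ is a $y$-global Finsler metric: it is smooth and positive on all of $TS^3\smallsetminus 0$, positively homogeneous of degree one in $y$, and strongly convex on all of $TS^3\smallsetminus 0$, that is, $(g_{ij})$ is positive definite there. 3. $F$ has constant flag curvature $K$: in every smooth chart of $S^3$, at every point and for every $y\neq0$, $$K^i_{\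 k}=K\,F^2\Big(\delta^i_{\ k}-\frac{y^i}{F}F_{y^k}\Big),$$ and every flag has flag curvature $K(y,V)=K$. -/

import Mathlib

open scoped Manifold ContDiff Quaternion

noncomputable section

namespace Finsler

/-! ### Local coordinate expressions

A function `F : E → E → ℝ` of `(x, y)` is a function of the base coordinates `x` and of the induced
fibre coordinates `y` of a chart. -/

/-- The coordinate space `ℝⁿ`. -/
abbrev E (n : ℕ) := EuclideanSpace ℝ (Fin n)

variable {n : ℕ}

/-- The partial derivative `∂f/∂xⁱ`. -/
def dx (i : Fin n) (f : E n → E n → ℝ) : E n → E n → ℝ :=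
  fun x y => fderiv ℝ (fun x' => f x' y) x (EuclideanSpace.single i 1)

/-- The partial derivative `∂f/∂yⁱ`. -/
def dy (i : Fin n) (f : E n → E n → ℝ) : E n → E n → ℝ :=
  fun x y => fderiv ℝ (fun y' => f x y') y (EuclideanSpace.single i 1)

/-- The fundamental tensor `g_ij = ½ (F²)_{yⁱ yʲ}`. -/
def fundamentalTensor (F : E n → E n → ℝ) (i j : Fin n) : E n → E n → ℝ :=
  fun x y => 1 / 2 * dy j (dy i (fun x' y' => F x' y' ^ 2)) x y

/-- The matrix `(g_ij)` of the fundamental tensor at `(x, y)`. -/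
def fundamentalMatrix (F : E n → E n → ℝ) (x y : E n) : Matrix (Fin n) (Fin n) ℝ :=
  Matrix.of fun i j => fundamentalTensor F i j x y

/-- The formal Christoffel symbols `γⁱ_jk = g^{il} ½ (∂g_lj/∂xᵏ - ∂g_jk/∂xˡ + ∂g_kl/∂xʲ)`. -/
def christoffel (F : E n → E n → ℝ) (i j k : Fin n) : E n → E n → ℝ :=
  fun x y => ∑ l, (fundamentalMatrix F x y)⁻¹ i l *
    (1 / 2 * (dx k (fundamentalTensor F l j) x y - dx l (fundamentalTensor F j k) x y
      + dx j (fundamentalTensor F k l) x y))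

/-- The geodesic spray coefficients `Gⁱ = ½ γⁱ_jk yʲ yᵏ`. -/
def sprayCoeff (F : E n → E n → ℝ) (i : Fin n) : E n → E n → ℝ :=
  fun x y => 1 / 2 * ∑ j, ∑ k, christoffel F i j k x y * y j * y k

/-- The spray curvature, by Berwald's formula
`Kⁱ_k = 2 (Gⁱ)_{xᵏ} - yʲ (Gⁱ)_{xʲ yᵏ} - (Gⁱ)_{yʲ} (Gʲ)_{yᵏ} + 2 Gʲ (Gⁱ)_{yʲ yᵏ}`. -/
def sprayCurvature (F : E n → E n → ℝ) (i k : Fin n) : E n → E n → ℝ :=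
  fun x y => 2 * dx k (sprayCoeff F i) x y
    - ∑ j, y j * dy k (dx j (sprayCoeff F i)) x y
    - ∑ j, dy j (sprayCoeff F i) x y * dy k (sprayCoeff F j) x y
    + 2 * ∑ j, sprayCoeff F j x y * dy k (dy j (sprayCoeff F i)) x y

/-- The inner product `g(U, W) = g_ij Uⁱ Wʲ` defined by the fundamental tensor at `(x, y)`. -/
def fundamentalForm (F : E n → E n → ℝ) (x y U W : E n) : ℝ :=
  ∑ i, ∑ j, fundamentalTensor F i j x y * U i * W j

/-- The flag curvature `Vⁱ K_ik Vᵏ / (g(y,y) g(V,V) - g(y,V)²)`, `K_ik = g_ij Kʲ_k`, of the flag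
with flagpole `y` and transverse edge `V`. -/
def flagCurvature (F : E n → E n → ℝ) (x y V : E n) : ℝ :=
  (∑ i, ∑ k, V i * (∑ j, fundamentalTensor F i j x y * sprayCurvature F j k x y) * V k) /
    (fundamentalForm F x y y y * fundamentalForm F x y V V - fundamentalForm F x y y V ^ 2)

/-! ### Finsler metrics on manifolds -/

variable {M : Type*} [TopologicalSpace M] [ChartedSpace (E n) M]

/-- The expression `F(x, yⁱ ∂/∂xⁱ)` of a function on the tangent bundle in the chart `e` of `M`. -/
def inChart (F : ∀ p : M, TangentSpace (𝓡 n) p → ℝ) (e : OpenPartialHomeomorph M (E n)) :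
    E n → E n → ℝ :=
  fun x y => F (e.symm x) (mfderiv (𝓡 n) (𝓡 n) e.symm x y)

/-- `F` is a `y`-global Finsler metric: it is smooth and positive on the whole slit tangent bundle,
positively homogeneous of degree one, and strongly convex, that is, its fundamental tensor is
positive definite on the whole slit tangent bundle. -/
structure IsYGlobalFinslerMetric [IsManifold (𝓡 n) ∞ M]
    (F : ∀ p : M, TangentSpace (𝓡 n) p → ℝ) : Prop where
  smooth : ContMDiffOn (𝓡 n).tangent 𝓘(ℝ, ℝ) ∞
    (fun v : TangentBundle (𝓡 n) M => F v.proj v.snd) {v | v.snd ≠ 0}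
  pos : ∀ (p : M) (v : TangentSpace (𝓡 n) p), v ≠ 0 → 0 < F p v
  homogeneous : ∀ (p : M) (c : ℝ) (v : TangentSpace (𝓡 n) p), 0 < c → F p (c • v) = c * F p v
  stronglyConvex : ∀ e ∈ IsManifold.maximalAtlas (𝓡 n) ∞ M, ∀ x ∈ e.target, ∀ y : E n, y ≠ 0 →
    (fundamentalMatrix (inChart F e) x y).PosDef

/-- `F` has constant flag curvature `κ`: every flag, given in any chart by a point `x`, a flagpole
`y` and a transverse edge `V`, has flag curvature `κ`. -/
def HasConstantFlagCurvature (F : ∀ p : M, TangentSpace (𝓡 n) p → ℝ) (κ : ℝ) : Prop :=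
  ∀ e ∈ IsManifold.maximalAtlas (𝓡 n) ∞ M, ∀ x ∈ e.target, ∀ y V : E n,
    LinearIndependent ℝ ![y, V] → flagCurvature (inChart F e) x y V = κ

/-- The tensor equation `Kⁱ_k = κ F² (δⁱ_k - (yⁱ/F) F_{yᵏ})` holds on the whole slit tangent
bundle, in every chart. -/
def SatisfiesSprayCriterion (F : ∀ p : M, TangentSpace (𝓡 n) p → ℝ) (κ : ℝ) : Prop :=
  ∀ e ∈ IsManifold.maximalAtlas (𝓡 n) ∞ M, ∀ x ∈ e.target, ∀ y : E n, y ≠ 0 → ∀ i k : Fin n,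
    sprayCurvature (inChart F e) i k x y =
      κ * inChart F e x y ^ 2 *
        ((if i = k then 1 else 0) - y i / inChart F e x y * dy k (inChart F e) x y)

/-- The field `b` of functions on the tangent spaces is a smooth `1`-form. -/
structure IsSmoothOneForm [IsManifold (𝓡 n) ∞ M]
    (b : ∀ p : M, TangentSpace (𝓡 n) p → ℝ) : Prop where
  linear : ∀ p : M, IsLinearMap ℝ (b p)
  smooth : ContMDiff (𝓡 n).tangent 𝓘(ℝ, ℝ) ∞
    (fun v : TangentBundle (𝓡 n) M => b v.proj v.snd)

/-- The field `a` of functions on pairs of tangent vectors is a smooth Riemannian metric. -/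
def IsRiemannianMetric [IsManifold (𝓡 n) ∞ M]
    (a : ∀ p : M, TangentSpace (𝓡 n) p → TangentSpace (𝓡 n) p → ℝ) : Prop :=
  ∃ g : Bundle.ContMDiffRiemannianMetric (𝓡 n) ∞ (E n) (fun p : M => TangentSpace (𝓡 n) p),
    ∀ (p : M) (v w : TangentSpace (𝓡 n) p), g.inner p v w = a p v w

/-- The Randers function `F = α + β`, `α(v) = √a(v, v)`, `β(v) = b(v)`. -/
def randers (a : ∀ p : M, TangentSpace (𝓡 n) p → TangentSpace (𝓡 n) p → ℝ)
    (b : ∀ p : M, TangentSpace (𝓡 n) p → ℝ) : ∀ p : M, TangentSpace (𝓡 n) p → ℝ :=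
  fun p v => Real.sqrt (a p v v) + b p v

/-- The norm `√(a^{ij} b_i b_j)` of a covector `b` with respect to an inner product `a`, where
`a_ij`, `b_i` are the components in the basis `B` and `(a^{ij})` is the inverse of `(a_ij)`. -/
def covectorNorm {V : Type*} [AddCommGroup V] [Module ℝ V] (a : V → V → ℝ) (b : V → ℝ)
    (B : Module.Basis (Fin n) ℝ V) : ℝ :=
  Real.sqrt (∑ i, ∑ j, (Matrix.of fun k l => a (B k) (B l))⁻¹ i j * b (B i) * b (B j))

/-! ### The Lie group `S³` of unit quaternions -/

instance finrank_quaternion_fact : Fact (Module.finrank ℝ ℍ[ℝ] = 3 + 1) :=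
  ⟨Quaternion.finrank_eq_four⟩

/-- The group `S³` of unit quaternions `x = x⁰ + x¹ i + x² j + x³ k`, as a smooth manifold. -/
abbrev S3 := Metric.sphere (0 : ℍ[ℝ]) 1

/-- A tangent vector of `S³`, seen in the ambient space `ℍ = ℝ⁴`; its components are
`dx⁰(v), dx¹(v), dx²(v), dx³(v)`. -/
def ambient (x : S3) (v : TangentSpace (𝓡 3) x) : ℍ[ℝ] :=
  mfderiv (𝓡 3) 𝓘(ℝ, ℍ[ℝ]) (fun z : S3 => (z : ℍ[ℝ])) x v

/-- `Θ¹ = -x¹ dx⁰ + x⁰ dx¹ - x³ dx² + x² dx³`. -/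
def theta1 (x : S3) (v : TangentSpace (𝓡 3) x) : ℝ :=
  -(x : ℍ[ℝ]).imI * (ambient x v).re + (x : ℍ[ℝ]).re * (ambient x v).imI
    - (x : ℍ[ℝ]).imK * (ambient x v).imJ + (x : ℍ[ℝ]).imJ * (ambient x v).imK

/-- `Θ² = -x² dx⁰ + x³ dx¹ + x⁰ dx² - x¹ dx³`. -/
def theta2 (x : S3) (v : TangentSpace (𝓡 3) x) : ℝ :=
  -(x : ℍ[ℝ]).imJ * (ambient x v).re + (x : ℍ[ℝ]).imK * (ambient x v).imI
    + (x : ℍ[ℝ]).re * (ambient x v).imJ - (x : ℍ[ℝ]).imI * (ambient x v).imK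

/-- `Θ³ = -x³ dx⁰ - x² dx¹ + x¹ dx² + x⁰ dx³`. -/
def theta3 (x : S3) (v : TangentSpace (𝓡 3) x) : ℝ :=
  -(x : ℍ[ℝ]).imK * (ambient x v).re - (x : ℍ[ℝ]).imJ * (ambient x v).imI
    + (x : ℍ[ℝ]).imI * (ambient x v).imJ + (x : ℍ[ℝ]).re * (ambient x v).imK

/-- `K Θ¹⊗Θ¹ + Θ²⊗Θ² + Θ³⊗Θ³`. -/
def aTilde (K : ℝ) (x : S3) (v w : TangentSpace (𝓡 3) x) : ℝ :=
  K * (theta1 x v * theta1 x w) + theta2 x v * theta2 x w + theta3 x v * theta3 x w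

/-- `σ √(K - 1) Θ¹`, where `σ` is a sign. -/
def bTilde (K σ : ℝ) (x : S3) (v : TangentSpace (𝓡 3) x) : ℝ :=
  σ * Real.sqrt (K - 1) * theta1 x v

/-- Invariance under all right translations `x ↦ x g` of the group `S³`. -/
def IsRightInvariant (a : ∀ x : S3, TangentSpace (𝓡 3) x → TangentSpace (𝓡 3) x → ℝ) : Prop :=
  ∀ (g x : S3) (v w : TangentSpace (𝓡 3) x),
    a (x * g) (mfderiv (𝓡 3) (𝓡 3) (fun z : S3 => z * g) x v)
      (mfderiv (𝓡 3) (𝓡 3) (fun z : S3 => z * g) x w) = a x v w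

end Finsler

end

/-!
Write `s = σ √(K - 1)`, so that `K = 1 + s²`. The coframe `Θ = (Θ¹, Θ², Θ³)` at `x` sends a
tangent vector `v` to the imaginary part of `v x̄`; it is injective, smooth and right-invariant,
and `F(v) = φ(Θ v)` for the fixed Randers norm `φ(w) = √(K w₀² + w₁² + w₂²) + s w₀` on `ℝ³`. This
gives the metric `ã`, the form `b̃` and the Finsler property of `F`, the latter since `φ` is a
Minkowski norm (`isMinkowskiNorm_randersNorm`, where strong convexity is the Cauchy–Schwarz
inequality for `ã`).

For the curvature, let `A(x)` be the matrix of `Θ` in an arbitrary chart, so that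
`F(x, y) = φ(A y)`. Symmetry of second derivatives gives the Maurer–Cartan equation
`(D_y A) z - (D_z A) y = [A y, A z]`, `[u, v] = 2 u × v` (`isMaurerCartanFrame_chart`). The
Euler–Lagrange equations then determine the spray: `2 A G = (D_y A) y + S(A y)`, where `S(w)` is
dual to `z ↦ ½ D(φ²)[w, z]` with respect to the fundamental tensor of `φ` (`sprayCoeff_eq`).
Differentiating this relation twice, all derivatives of `A` cancel from Berwald's formula because
of the Maurer–Cartan equation, and `A` carries the spray curvature to the operator
`z ↦ ½ [S, z] - DS [w, z] + ½ D²S(z, S) - ¼ (DS - [w, ·])² z` at `w = A y`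
(`apply_sprayCurvature`).

For the present norm `S(w) = s φ(w) [i, w]`. Since `φ` satisfies `φ² - 2 s w₀ φ = |w|²` and is
invariant under rotations about the axis `i`, the operator is `(1 + s²) φ (φ z - Dφ(z) w)`
(`invariantCurvature_randersSpray`). This is the asserted equation for the spray curvature, and
constant flag curvature follows from it by Euler's relation (`flagCurvature_eq`).
-/

noncomputable section

namespace Finsler

open Filter Topology

variable {n : ℕ}

/-! ### Partial derivatives in coordinates -/

lemma sum_apply_smul_single {V : Type*} [AddCommGroup V] [Module ℝ V] [TopologicalSpace V]
    (T : E n →L[ℝ] V) (y : E n) : ∑ j, y j • T (EuclideanSpace.single j 1) = T y := by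
  have h := (EuclideanSpace.basisFun (Fin n) ℝ).sum_repr y
  conv_rhs => rw [← h]
  simp

lemma sum_mul_apply_single (T : E n →L[ℝ] ℝ) (y : E n) :
    ∑ j, y j * T (EuclideanSpace.single j 1) = T y := by
  simpa using sum_apply_smul_single T y

lemma fderiv_apply_coord {V : Type*} [NormedAddCommGroup V] [NormedSpace ℝ V] {f : V → E n} {x : V}
    (hf : DifferentiableAt ℝ f x) (i : Fin n) (v : V) :
    fderiv ℝ (fun x' => f x' i) x v = fderiv ℝ f x v i := by
  have h := ((EuclideanSpace.proj (𝕜 := ℝ) i).hasFDerivAt (x := f x)).comp x hf.hasFDerivAt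
  have h2 : (⇑(EuclideanSpace.proj (𝕜 := ℝ) i) ∘ f) = fun x' => f x' i := rfl
  rw [h2] at h
  rw [h.fderiv]
  rfl

lemma hasFDerivAt_clm_apply_const {V W Z : Type*} [NormedAddCommGroup V] [NormedSpace ℝ V]
    [NormedAddCommGroup W] [NormedSpace ℝ W] [NormedAddCommGroup Z] [NormedSpace ℝ Z]
    {f : V → W →L[ℝ] Z} {x : V} (hf : DifferentiableAt ℝ f x) (w : W) :
    HasFDerivAt (fun x' => f x' w) ((fderiv ℝ f x).flip w) x := by
  convert hf.hasFDerivAt.clm_apply (hasFDerivAt_const w x) using 1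
  ext v; simp

lemma fderiv_clm_apply_const {V W Z : Type*} [NormedAddCommGroup V] [NormedSpace ℝ V]
    [NormedAddCommGroup W] [NormedSpace ℝ W] [NormedAddCommGroup Z] [NormedSpace ℝ Z]
    {f : V → W →L[ℝ] Z} {x : V} (hf : DifferentiableAt ℝ f x) (w : W) (v : V) :
    fderiv ℝ (fun x' => f x' w) x v = fderiv ℝ f x v w := by
  rw [(hasFDerivAt_clm_apply_const hf w).fderiv]; rfl

section Partial

variable {V : Type*} [NormedAddCommGroup V] [NormedSpace ℝ V] {G : E n → E n → V} {x y : E n}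

lemma contDiffAt_partial_fst (hG : ContDiffAt ℝ ∞ (Function.uncurry G) (x, y)) :
    ContDiffAt ℝ ∞ (fun x' => G x' y) x :=
  ContDiffAt.comp (f := fun x' => (x', y)) x hG (by fun_prop)

lemma contDiffAt_partial_snd (hG : ContDiffAt ℝ ∞ (Function.uncurry G) (x, y)) :
    ContDiffAt ℝ ∞ (G x) y :=
  ContDiffAt.comp (f := fun y' => (x, y')) y hG (by fun_prop)

lemma contDiffAt_fderiv_partial_fst (hG : ContDiffAt ℝ ∞ (Function.uncurry G) (x, y)) :
    ContDiffAt ℝ ∞ (fun y' => fderiv ℝ (fun x' => G x' y') x) y := by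
  refine ContDiffAt.fderiv (n := ∞) (f := fun y' x' => G x' y') (g := fun _ => x) ?_
    contDiffAt_const (by simp)
  exact ContDiffAt.comp (f := fun p : E n × E n => (p.2, p.1)) (y, x) hG (by fun_prop)

end Partial

/-! ### Spray curvature of an explicit spray -/

lemma isOpen_slit {U : Set (E n)} (hU : IsOpen U) : IsOpen (U ×ˢ ({0}ᶜ : Set (E n))) :=
  hU.prod isOpen_compl_singleton

lemma contDiffAt_of_slit {V : Type*} [NormedAddCommGroup V] [NormedSpace ℝ V]
    {U : Set (E n)} (hU : IsOpen U) {G : E n → E n → V}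
    (hG : ContDiffOn ℝ ∞ (Function.uncurry G) (U ×ˢ {0}ᶜ)) {x y : E n} (hx : x ∈ U) (hy : y ≠ 0) :
    ContDiffAt ℝ ∞ (Function.uncurry G) (x, y) :=
  hG.contDiffAt ((isOpen_slit hU).mem_nhds ⟨hx, hy⟩)

lemma eventually_ne_zero {y : E n} (hy : y ≠ 0) : ∀ᶠ y' in 𝓝 y, y' ≠ 0 :=
  isOpen_compl_singleton.mem_nhds hy

/-- Berwald's formula for a spray whose coefficients are the components of a smooth
vector-valued map `G`, with the sums over coordinates absorbed into the total derivatives of `G`. -/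
lemma sprayCurvature_eq_of_sprayCoeff_eq {F : E n → E n → ℝ} {U : Set (E n)} (hU : IsOpen U)
    {G : E n → E n → E n} (hG : ContDiffOn ℝ ∞ (Function.uncurry G) (U ×ˢ {0}ᶜ))
    (hFG : ∀ x ∈ U, ∀ y, y ≠ 0 → ∀ i, sprayCoeff F i x y = G x y i)
    {x y : E n} (hx : x ∈ U) (hy : y ≠ 0) (i k : Fin n) :
    sprayCurvature F i k x y =
      ((2 : ℝ) • fderiv ℝ (fun x' => G x' y) x (EuclideanSpace.single k 1)
        - fderiv ℝ (fun y' => fderiv ℝ (fun x' => G x' y') x) y (EuclideanSpace.single k 1) y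
        - fderiv ℝ (G x) y (fderiv ℝ (G x) y (EuclideanSpace.single k 1))
        + (2 : ℝ) • fderiv ℝ (fderiv ℝ (G x)) y (EuclideanSpace.single k 1) (G x y)) i := by
  have hGs := fun {y'} (hy' : y' ≠ 0) => contDiffAt_of_slit hU hG hx hy'
  have hdx : ∀ y', y' ≠ 0 → ∀ i j, dx j (sprayCoeff F i) x y' =
      fderiv ℝ (fun x' => G x' y') x (EuclideanSpace.single j 1) i := by
    intro y' hy' i j
    have h : (fun x' => sprayCoeff F i x' y') =ᶠ[𝓝 x] fun x' => G x' y' i := by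
      filter_upwards [hU.mem_nhds hx] with x' hx' using hFG x' hx' y' hy' i
    rw [dx, h.fderiv_eq, fderiv_apply_coord]
    exact (contDiffAt_partial_fst (hGs hy')).differentiableAt (by simp)
  have hdy : ∀ y', y' ≠ 0 → ∀ i j, dy j (sprayCoeff F i) x y' =
      fderiv ℝ (G x) y' (EuclideanSpace.single j 1) i := by
    intro y' hy' i j
    have h : (fun y' => sprayCoeff F i x y') =ᶠ[𝓝 y'] fun y' => G x y' i := by
      filter_upwards [eventually_ne_zero hy'] with y' hy' using hFG x hx y' hy' i
    rw [dy, h.fderiv_eq, fderiv_apply_coord]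
    exact (contDiffAt_partial_snd (hGs hy')).differentiableAt (by simp)
  have hdxdy : ∀ i j, dy k (dx j (sprayCoeff F i)) x y =
      fderiv ℝ (fun y' => fderiv ℝ (fun x' => G x' y') x) y (EuclideanSpace.single k 1)
        (EuclideanSpace.single j 1) i := by
    intro i j
    have h : (fun y' => dx j (sprayCoeff F i) x y') =ᶠ[𝓝 y]
        fun y' => fderiv ℝ (fun x' => G x' y') x (EuclideanSpace.single j 1) i := by
      filter_upwards [eventually_ne_zero hy] with y' hy' using hdx y' hy' i j
    have hd := (contDiffAt_fderiv_partial_fst (hGs hy)).differentiableAt (by simp)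
    rw [dy, h.fderiv_eq, fderiv_apply_coord, fderiv_clm_apply_const hd]
    exact (hasFDerivAt_clm_apply_const hd _).differentiableAt
  have hdydy : ∀ i j, dy k (dy j (sprayCoeff F i)) x y =
      fderiv ℝ (fderiv ℝ (G x)) y (EuclideanSpace.single k 1)
        (EuclideanSpace.single j 1) i := by
    intro i j
    have h : (fun y' => dy j (sprayCoeff F i) x y') =ᶠ[𝓝 y]
        fun y' => fderiv ℝ (G x) y' (EuclideanSpace.single j 1) i := by
      filter_upwards [eventually_ne_zero hy] with y' hy' using hdy y' hy' i j
    have hd : DifferentiableAt ℝ (fderiv ℝ (G x)) y :=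
      ((contDiffAt_partial_snd (hGs hy)).fderiv_right (m := ∞) (by simp)).differentiableAt (by simp)
    rw [dy, h.fderiv_eq, fderiv_apply_coord, fderiv_clm_apply_const hd]
    exact (hasFDerivAt_clm_apply_const hd _).differentiableAt
  have hsum : ∀ (T : E n →L[ℝ] E n) (v : E n),
      ∑ j, v j * T (EuclideanSpace.single j 1) i = T v i := fun T v =>
    sum_mul_apply_single ((EuclideanSpace.proj (𝕜 := ℝ) i).comp T) v
  have h3 : ∑ j, dy j (sprayCoeff F i) x y * dy k (sprayCoeff F j) x y =
      fderiv ℝ (G x) y (fderiv ℝ (G x) y (EuclideanSpace.single k 1)) i := by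
    rw [← hsum]
    exact Finset.sum_congr rfl fun j _ => by rw [hdy y hy, hdy y hy, mul_comm]
  simp only [sprayCurvature, h3, hdxdy, hdydy, hdx y hy, hFG x hx y hy, hsum]
  simp

/-! ### Sprays in a Maurer–Cartan frame -/

/-- A smooth field `A` of linear coordinates on the fibres over `U` with the structure equation
`(D_y A) z - (D_z A) y = [A y, A z]` for the bracket `br`. The model is the right-invariant
Maurer–Cartan form of a Lie group in a chart, with the bracket written in a basis of the
Lie algebra. -/
structure IsMaurerCartanFrame (br : E n →L[ℝ] E n →L[ℝ] E n) (U : Set (E n))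
    (A : E n → E n →L[ℝ] E n) : Prop where
  isOpen : IsOpen U
  contDiffOn : ContDiffOn ℝ ∞ A U
  injective : ∀ x ∈ U, Function.Injective (A x)
  structure_eq : ∀ x ∈ U, ∀ y z, fderiv ℝ A x y z - fderiv ℝ A x z y = br (A x y) (A x z)

/-- The spray `G(x, y)` of the system `w' = -S(w)` for the velocity `w = A y` in the frame: the
solution of `2 A G = (D_y A) y + S(A y)`. It is meaningful where `A x` is invertible. -/
def frameSpray (A : E n → E n →L[ℝ] E n) (S : E n → E n) (x y : E n) : E n :=
  (1 / 2 : ℝ) • (A x).inverse (fderiv ℝ A x y y + S (A x y))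

/-- The curvature operator at `w` of the invariant spray `w' = -S(w)` on a Lie group, in terms of
the frame only. It is the curvature of the Jacobi equation `(d/dt + DS)(d/dt - [w, ·]) z = 0`, whose
covariant derivative is `d/dt + ½ (DS - [w, ·])`. -/
def invariantCurvature (br : E n →L[ℝ] E n →L[ℝ] E n) (S : E n → E n) (w z : E n) : E n :=
  (1 / 2 : ℝ) • br (S w) z - fderiv ℝ S w (br w z)
    + (1 / 2 : ℝ) • fderiv ℝ (fderiv ℝ S) w z (S w)
    - (1 / 4 : ℝ) • (fderiv ℝ S w (fderiv ℝ S w z - br w z) - br w (fderiv ℝ S w z - br w z))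

namespace IsMaurerCartanFrame

variable {br : E n →L[ℝ] E n →L[ℝ] E n} {U : Set (E n)} {A : E n → E n →L[ℝ] E n} {S : E n → E n}

lemma contDiffAt (hA : IsMaurerCartanFrame br U A) {x : E n} (hx : x ∈ U) : ContDiffAt ℝ ∞ A x :=
  hA.contDiffOn.contDiffAt (hA.isOpen.mem_nhds hx)

lemma contDiffAt_fderiv (hA : IsMaurerCartanFrame br U A) {x : E n} (hx : x ∈ U) :
    ContDiffAt ℝ ∞ (fderiv ℝ A) x :=
  (hA.contDiffAt hx).fderiv_right (by simp)

lemma exists_equiv (hA : IsMaurerCartanFrame br U A) {x : E n} (hx : x ∈ U) :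
    ∃ e : E n ≃L[ℝ] E n, (e : E n →L[ℝ] E n) = A x :=
  ⟨(LinearEquiv.ofInjectiveEndo (A x).toLinearMap (hA.injective x hx)).toContinuousLinearEquiv,
    by ext; rfl⟩

lemma apply_inverse (hA : IsMaurerCartanFrame br U A) {x : E n} (hx : x ∈ U) (v : E n) :
    A x ((A x).inverse v) = v := by
  obtain ⟨e, he⟩ := hA.exists_equiv hx
  rw [← he, ContinuousLinearMap.inverse_equiv]
  simp

lemma apply_ne_zero (hA : IsMaurerCartanFrame br U A) {x : E n} (hx : x ∈ U) {y : E n}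
    (hy : y ≠ 0) : A x y ≠ 0 := fun h => hy (hA.injective x hx (h.trans (map_zero _).symm))

lemma apply_frameSpray (hA : IsMaurerCartanFrame br U A) {x : E n} (hx : x ∈ U) (y : E n) :
    (2 : ℝ) • A x (frameSpray A S x y) = fderiv ℝ A x y y + S (A x y) := by
  rw [frameSpray, map_smul, hA.apply_inverse hx]
  module

lemma contDiffOn_frameSpray (hA : IsMaurerCartanFrame br U A) (hS : ContDiffOn ℝ ∞ S {0}ᶜ) :
    ContDiffOn ℝ ∞ (Function.uncurry (frameSpray A S)) (U ×ˢ {0}ᶜ) := by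
  rintro ⟨x, y⟩ ⟨hx, hy⟩
  apply ContDiffAt.contDiffWithinAt
  have h1 : ContDiffAt ℝ ∞ (fun p : E n × E n => A p.1) (x, y) :=
    ContDiffAt.comp (x, y) (hA.contDiffAt hx) contDiffAt_fst
  have h2 : ContDiffAt ℝ ∞ (fun p : E n × E n => fderiv ℝ A p.1) (x, y) :=
    ContDiffAt.comp (x, y) (hA.contDiffAt_fderiv hx) contDiffAt_fst
  have h3 : ContDiffAt ℝ ∞ (fun p : E n × E n => (A p.1).inverse) (x, y) := by
    obtain ⟨e, he⟩ := hA.exists_equiv hx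
    have h := contDiffAt_map_inverse (𝕜 := ℝ) (n := ∞) e
    rw [he] at h
    exact ContDiffAt.comp (x, y) h h1
  have h4 : ContDiffAt ℝ ∞ (fun p : E n × E n => S (A p.1 p.2)) (x, y) :=
    ContDiffAt.comp (x, y) (hS.contDiffAt (isOpen_compl_singleton.mem_nhds
      (hA.apply_ne_zero hx hy))) (h1.clm_apply contDiffAt_snd)
  exact (contDiffAt_const (c := (1 / 2 : ℝ))).smul (h3.clm_apply
    (((h2.clm_apply contDiffAt_snd).clm_apply contDiffAt_snd).add h4))

end IsMaurerCartanFrame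

namespace IsMaurerCartanFrame

variable {br : E n →L[ℝ] E n →L[ℝ] E n} {U : Set (E n)} {A : E n → E n →L[ℝ] E n} {S : E n → E n}

/-- The derivative of the structure equation. -/
lemma fderiv_structure_eq (hA : IsMaurerCartanFrame br U A) {x : E n} (hx : x ∈ U) (v y z : E n) :
    fderiv ℝ (fderiv ℝ A) x v y z - fderiv ℝ (fderiv ℝ A) x v z y =
      br (fderiv ℝ A x v y) (A x z) + br (A x y) (fderiv ℝ A x v z) := by
  have hd1 := ((hA.contDiffAt hx).differentiableAt (by simp)).hasFDerivAt
  have hd2 := ((hA.contDiffAt_fderiv hx).differentiableAt (by simp)).hasFDerivAt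
  have hc : ∀ w : E n, HasFDerivAt (fun _ : E n => w) (0 : E n →L[ℝ] E n) x :=
    fun w => hasFDerivAt_const w x
  have hl := ((hd2.clm_apply (hc y)).clm_apply (hc z)).sub
    ((hd2.clm_apply (hc z)).clm_apply (hc y))
  have hr := ((br.hasFDerivAt.comp x (hd1.clm_apply (hc y))).clm_apply (hd1.clm_apply (hc z)))
  have he := hl.congr_of_eventuallyEq (f₁ := fun x' => br (A x' y) (A x' z))
    (by filter_upwards [hA.isOpen.mem_nhds hx] with x' hx'
        exact (hA.structure_eq x' hx' y z).symm)
  have := congrArg (fun T : E n →L[ℝ] E n => T v) (he.unique hr)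
  simpa [add_comm] using this

lemma fderiv_fderiv_comm (hA : IsMaurerCartanFrame br U A) {x : E n} (hx : x ∈ U) (v w : E n) :
    fderiv ℝ (fderiv ℝ A) x v w = fderiv ℝ (fderiv ℝ A) x w v :=
  (hA.contDiffAt hx).isSymmSndFDerivAt (by simp; exact WithTop.coe_le_coe.2 le_top) v w

section Spray

variable (hA : IsMaurerCartanFrame br U A) (hS : ContDiffOn ℝ ∞ S {0}ᶜ) {x y : E n}
include hA hS

lemma contDiffAt_spray (hx : x ∈ U) (hy : y ≠ 0) :
    ContDiffAt ℝ ∞ S (A x y) :=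
  hS.contDiffAt (isOpen_compl_singleton.mem_nhds (hA.apply_ne_zero hx hy))

lemma contDiffAt_uncurry_frameSpray (hx : x ∈ U) (hy : y ≠ 0) :
    ContDiffAt ℝ ∞ (Function.uncurry (frameSpray A S)) (x, y) :=
  contDiffAt_of_slit hA.isOpen (hA.contDiffOn_frameSpray hS) hx hy

lemma hasFDerivAt_spray (hx : x ∈ U) (hy : y ≠ 0) :
    HasFDerivAt S (fderiv ℝ S (A x y)) (A x y) :=
  ((hA.contDiffAt_spray hS hx hy).differentiableAt (by simp)).hasFDerivAt

lemma hasFDerivAt_fderiv_spray (hx : x ∈ U) (hy : y ≠ 0) :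
    HasFDerivAt (fderiv ℝ S) (fderiv ℝ (fderiv ℝ S) (A x y)) (A x y) :=
  (((hA.contDiffAt_spray hS hx hy).fderiv_right (m := ∞) (by simp)).differentiableAt
    (by simp)).hasFDerivAt

/-- The `y`-derivative of the relation `2 A G = (D_y A) y + S(A y)`. -/
lemma apply_fderiv_snd (hx : x ∈ U) (hy : y ≠ 0) (z : E n) :
    (2 : ℝ) • A x (fderiv ℝ (frameSpray A S x) y z) =
      fderiv ℝ A x z y + fderiv ℝ A x y z + fderiv ℝ S (A x y) (A x z) := by
  have hG := ((contDiffAt_partial_snd (hA.contDiffAt_uncurry_frameSpray hS hx hy)).differentiableAt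
    (by simp)).hasFDerivAt
  have hl := ((A x).hasFDerivAt.comp y hG).const_smul (2 : ℝ)
  have hr := ((fderiv ℝ A x).hasFDerivAt.clm_apply (hasFDerivAt_id y)).add
    ((hA.hasFDerivAt_spray hS hx hy).comp y (A x).hasFDerivAt)
  have he := hr.congr_of_eventuallyEq (f₁ := fun y' => (2 : ℝ) • A x (frameSpray A S x y'))
    (.of_forall fun y' => hA.apply_frameSpray hx y')
  have := congrArg (fun T : E n →L[ℝ] E n => T z) (hl.unique he)
  simpa [add_comm] using this

/-- The `x`-derivative of the relation `2 A G = (D_y A) y + S(A y)`. -/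
lemma apply_fderiv_fst (hx : x ∈ U) (hy : y ≠ 0) (z : E n) :
    (2 : ℝ) • fderiv ℝ A x z (frameSpray A S x y)
        + (2 : ℝ) • A x (fderiv ℝ (fun x' => frameSpray A S x' y) x z) =
      fderiv ℝ (fderiv ℝ A) x z y y + fderiv ℝ S (A x y) (fderiv ℝ A x z y) := by
  have hG := ((contDiffAt_partial_fst (hA.contDiffAt_uncurry_frameSpray hS hx hy)).differentiableAt
    (by simp)).hasFDerivAt
  have hd1 := ((hA.contDiffAt hx).differentiableAt (by simp)).hasFDerivAt
  have hd2 := ((hA.contDiffAt_fderiv hx).differentiableAt (by simp)).hasFDerivAt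
  have hc : ∀ w : E n, HasFDerivAt (fun _ : E n => w) (0 : E n →L[ℝ] E n) x :=
    fun w => hasFDerivAt_const w x
  have hl := (hd1.clm_apply hG).const_smul (2 : ℝ)
  have hr := ((hd2.clm_apply (hc y)).clm_apply (hc y)).add
    ((hA.hasFDerivAt_spray hS hx hy).comp x (hd1.clm_apply (hc y)))
  have he := hr.congr_of_eventuallyEq (f₁ := fun x' => (2 : ℝ) • A x' (frameSpray A S x' y))
    (by filter_upwards [hA.isOpen.mem_nhds hx] with x' hx' using hA.apply_frameSpray hx' y)
  have := congrArg (fun T : E n →L[ℝ] E n => T z) (hl.unique he)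
  simpa [add_comm] using this

/-- The mixed derivative, first in `x` along `z` and then in `y` along `k`, of the relation
`2 A G = (D_y A) y + S(A y)`. -/
lemma apply_fderiv_snd_fst (hx : x ∈ U) (hy : y ≠ 0) (z k : E n) :
    (2 : ℝ) • fderiv ℝ A x z (fderiv ℝ (frameSpray A S x) y k)
        + (2 : ℝ) • A x (fderiv ℝ (fun y' => fderiv ℝ (fun x' => frameSpray A S x' y') x) y k z) =
      fderiv ℝ (fderiv ℝ A) x z k y + fderiv ℝ (fderiv ℝ A) x z y k
        + fderiv ℝ (fderiv ℝ S) (A x y) (A x k) (fderiv ℝ A x z y)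
        + fderiv ℝ S (A x y) (fderiv ℝ A x z k) := by
  have hGs := hA.contDiffAt_uncurry_frameSpray hS hx hy
  have hG := ((contDiffAt_partial_snd hGs).differentiableAt (by simp)).hasFDerivAt
  have hGx := ((contDiffAt_fderiv_partial_fst hGs).differentiableAt (by simp)).hasFDerivAt
  have hl := (((fderiv ℝ A x z).hasFDerivAt.comp y hG).const_smul (2 : ℝ)).add
    (((A x).hasFDerivAt.comp y (hGx.clm_apply (hasFDerivAt_const z y))).const_smul (2 : ℝ))
  have hr := ((fderiv ℝ (fderiv ℝ A) x z).hasFDerivAt.clm_apply (hasFDerivAt_id y)).add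
    (((hA.hasFDerivAt_fderiv_spray hS hx hy).comp y (A x).hasFDerivAt).clm_apply
      (fderiv ℝ A x z).hasFDerivAt)
  have he := hr.congr_of_eventuallyEq (f₁ := fun y' =>
      (2 : ℝ) • fderiv ℝ A x z (frameSpray A S x y')
        + (2 : ℝ) • A x (fderiv ℝ (fun x' => frameSpray A S x' y') x z))
    (by filter_upwards [eventually_ne_zero hy] with y' hy' using hA.apply_fderiv_fst hS hx hy' z)
  have := congrArg (fun T : E n →L[ℝ] E n => T k) (hl.unique he)
  simp only [_root_.add_apply, _root_.smul_apply,
    ContinuousLinearMap.comp_apply, ContinuousLinearMap.flip_apply, Function.comp_apply,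
    _root_.zero_apply, map_zero, zero_add, id_eq, ContinuousLinearMap.id_apply] at this
  rw [this]
  abel

/-- The second `y`-derivative of the relation `2 A G = (D_y A) y + S(A y)`. -/
lemma apply_fderiv_snd_snd (hx : x ∈ U) (hy : y ≠ 0) (z k : E n) :
    (2 : ℝ) • A x (fderiv ℝ (fderiv ℝ (frameSpray A S x)) y k z) =
      fderiv ℝ A x z k + fderiv ℝ A x k z
        + fderiv ℝ (fderiv ℝ S) (A x y) (A x k) (A x z) := by
  have hGs := hA.contDiffAt_uncurry_frameSpray hS hx hy
  have hG := (((contDiffAt_partial_snd hGs).fderiv_right (m := ∞) (by simp)).differentiableAt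
    (by simp)).hasFDerivAt
  have hl := ((A x).hasFDerivAt.comp y (hG.clm_apply (hasFDerivAt_const z y))).const_smul (2 : ℝ)
  have hr := ((fderiv ℝ A x z).hasFDerivAt.add
      ((fderiv ℝ A x).hasFDerivAt.clm_apply (hasFDerivAt_const z y))).add
    (((hA.hasFDerivAt_fderiv_spray hS hx hy).comp y (A x).hasFDerivAt).clm_apply
      (hasFDerivAt_const (A x z) y))
  have he := hr.congr_of_eventuallyEq (f₁ := fun y' =>
      (2 : ℝ) • A x (fderiv ℝ (frameSpray A S x) y' z))
    (by filter_upwards [eventually_ne_zero hy] with y' hy' using hA.apply_fderiv_snd hS hx hy' z)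
  have := congrArg (fun T : E n →L[ℝ] E n => T k) (hl.unique he)
  simpa using this

/-- The frame carries the spray curvature to the invariant curvature operator: all terms
containing derivatives of the frame cancel, by the structure equation and its derivative. -/
lemma apply_sprayCurvature (hx : x ∈ U) (hy : y ≠ 0) (k : E n) :
    A x ((2 : ℝ) • fderiv ℝ (fun x' => frameSpray A S x' y) x k
        - fderiv ℝ (fun y' => fderiv ℝ (fun x' => frameSpray A S x' y') x) y k y
        - fderiv ℝ (frameSpray A S x) y (fderiv ℝ (frameSpray A S x) y k)
        + (2 : ℝ) • fderiv ℝ (fderiv ℝ (frameSpray A S x)) y k (frameSpray A S x y)) =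
      invariantCurvature br S (A x y) (A x k) := by
  have h0 := hA.apply_frameSpray (S := S) hx y
  have h1 := hA.apply_fderiv_fst hS hx hy k
  have h2 := hA.apply_fderiv_snd_fst hS hx hy y k
  have h3 := hA.apply_fderiv_snd hS hx hy k
  have h4 := hA.apply_fderiv_snd hS hx hy (fderiv ℝ (frameSpray A S x) y k)
  have h5 := hA.apply_fderiv_snd_snd hS hx hy (frameSpray A S x y) k
  have c1 := hA.structure_eq x hx y k
  have c2 := hA.structure_eq x hx (frameSpray A S x y) k
  have c3 := hA.fderiv_structure_eq hx y y k
  have c4 := hA.structure_eq x hx y (fderiv ℝ (frameSpray A S x) y k)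
  rw [hA.fderiv_fderiv_comm hx k y] at h1
  -- from here on the claim is linear algebra in the derivatives of `G` and of `A`
  generalize frameSpray A S x y = G at *
  generalize fderiv ℝ (fun x' => frameSpray A S x' y) x k = Gx at *
  generalize fderiv ℝ (fun y' => fderiv ℝ (fun x' => frameSpray A S x' y') x) y k y = Gxy at *
  generalize fderiv ℝ (fderiv ℝ (frameSpray A S x)) y k G = Gyy at *
  generalize fderiv ℝ (frameSpray A S x) y (fderiv ℝ (frameSpray A S x) y k) = NN at *
  generalize fderiv ℝ (frameSpray A S x) y k = N at *
  have h6 : A x N = (1 / 2 : ℝ) • (fderiv ℝ A x k y + fderiv ℝ A x y k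
      + fderiv ℝ S (A x y) (A x k)) := by rw [← h3]; module
  have h7 : A x G = (1 / 2 : ℝ) • (fderiv ℝ A x y y + S (A x y)) := by rw [← h0]; module
  have h8 : fderiv ℝ A x k y = fderiv ℝ A x y k - br (A x y) (A x k) := by rw [← c1]; abel
  rw [h8] at h6 h1
  rw [h6] at h4 c4
  rw [h7] at h5 c2
  simp only [map_sub, map_add, map_smul, invariantCurvature, _root_.add_apply,
    _root_.smul_apply] at *
  generalize fderiv ℝ A x y k = a at *
  generalize fderiv ℝ S (A x y) a = b at *
  linear_combination (norm := module) h1 - (1 / 2 : ℝ) • h2 - (1 / 2 : ℝ) • h4 + h5 + c2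
    - (1 / 2 : ℝ) • c3 + (1 / 2 : ℝ) • c4

/-- The Berwald spray curvature of a Finsler function whose spray is `frameSpray A S`. -/
lemma apply_sprayCurvature_of_sprayCoeff_eq {F : E n → E n → ℝ}
    (hFG : ∀ x ∈ U, ∀ y, y ≠ 0 → ∀ i, sprayCoeff F i x y = frameSpray A S x y i)
    (hx : x ∈ U) (hy : y ≠ 0) (k : Fin n) :
    A x (WithLp.toLp 2 fun i => sprayCurvature F i k x y) =
      invariantCurvature br S (A x y) (A x (EuclideanSpace.single k 1)) := by
  rw [← hA.apply_sprayCurvature hS hx hy]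
  congr 1
  ext i
  exact sprayCurvature_eq_of_sprayCoeff_eq hA.isOpen (hA.contDiffOn_frameSpray hS) hFG hx hy i k

end Spray

end IsMaurerCartanFrame

/-! ### Minkowski norms -/

/-- The fundamental tensor `½ D²(φ²)` of a function on a vector space. -/
def minkowskiTensor (φ : E n → ℝ) (w : E n) : E n →L[ℝ] E n →L[ℝ] ℝ :=
  (1 / 2 : ℝ) • fderiv ℝ (fderiv ℝ fun v => φ v ^ 2) w

lemma minkowskiTensor_apply {φ : E n → ℝ} {w : E n} (hφ : ContDiffAt ℝ ∞ φ w) (u v : E n) :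
    minkowskiTensor φ w u v =
      φ w * fderiv ℝ (fderiv ℝ φ) w u v + fderiv ℝ φ w u * fderiv ℝ φ w v := by
  have hd : ∀ᶠ w' in 𝓝 w, DifferentiableAt ℝ φ w' :=
    ((hφ.of_le (m := 1) (by simp)).eventually (by simp)).mono
      fun _ h => h.differentiableAt (by simp)
  have h2 := ((hφ.fderiv_right (m := ∞) (by simp)).differentiableAt (by simp)).hasFDerivAt
  have h3 := (((hd.self_of_nhds.hasFDerivAt).const_mul (2 : ℝ)).smul h2).congr_of_eventuallyEq
    (f₁ := fderiv ℝ fun v => φ v ^ 2) (by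
      filter_upwards [hd] with w' hw'
      rw [(hw'.hasFDerivAt.pow 2).fderiv]
      ext v; simp)
  rw [minkowskiTensor, h3.fderiv]
  simp
  ring

/-- A Minkowski norm: smooth and positive off the origin, positively homogeneous of degree one,
strongly convex. It need not be reversible. -/
structure IsMinkowskiNorm (φ : E n → ℝ) : Prop where
  contDiffOn : ContDiffOn ℝ ∞ φ {0}ᶜ
  pos : ∀ w, w ≠ 0 → 0 < φ w
  homogeneous : ∀ c : ℝ, 0 < c → ∀ w, φ (c • w) = c * φ w
  posDef : ∀ w, w ≠ 0 → ∀ v, v ≠ 0 → 0 < minkowskiTensor φ w v v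

namespace IsMinkowskiNorm

variable {φ : E n → ℝ} {w : E n}

lemma contDiffAt (hφ : IsMinkowskiNorm φ) (hw : w ≠ 0) : ContDiffAt ℝ ∞ φ w :=
  hφ.contDiffOn.contDiffAt (isOpen_compl_singleton.mem_nhds hw)

lemma hasFDerivAt (hφ : IsMinkowskiNorm φ) (hw : w ≠ 0) : HasFDerivAt φ (fderiv ℝ φ w) w :=
  ((hφ.contDiffAt hw).differentiableAt (by simp)).hasFDerivAt

lemma contDiffAt_sq (hφ : IsMinkowskiNorm φ) (hw : w ≠ 0) :
    ContDiffAt ℝ ∞ (fun v => φ v ^ 2) w := (hφ.contDiffAt hw).pow 2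

lemma hasFDerivAt_sq (hφ : IsMinkowskiNorm φ) (hw : w ≠ 0) :
    HasFDerivAt (fun v => φ v ^ 2) (fderiv ℝ (fun v => φ v ^ 2) w) w :=
  ((hφ.contDiffAt_sq hw).differentiableAt (by simp)).hasFDerivAt

lemma contDiffAt_fderiv_sq (hφ : IsMinkowskiNorm φ) (hw : w ≠ 0) :
    ContDiffAt ℝ ∞ (fderiv ℝ fun v => φ v ^ 2) w := (hφ.contDiffAt_sq hw).fderiv_right (by simp)

lemma hasFDerivAt_fderiv_sq (hφ : IsMinkowskiNorm φ) (hw : w ≠ 0) :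
    HasFDerivAt (fderiv ℝ fun v => φ v ^ 2) ((2 : ℝ) • minkowskiTensor φ w) w := by
  rw [minkowskiTensor, smul_smul]
  norm_num
  exact ((hφ.contDiffAt_fderiv_sq hw).differentiableAt (by simp)).hasFDerivAt

lemma contDiffAt_minkowskiTensor (hφ : IsMinkowskiNorm φ) (hw : w ≠ 0) :
    ContDiffAt ℝ ∞ (minkowskiTensor φ) w :=
  ((hφ.contDiffAt_fderiv_sq hw).fderiv_right (m := ∞) (by simp)).const_smul (1 / 2 : ℝ)

lemma fderiv_sq (hφ : IsMinkowskiNorm φ) (hw : w ≠ 0) (v : E n) :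
    fderiv ℝ (fun v => φ v ^ 2) w v = 2 * (φ w * fderiv ℝ φ w v) := by
  rw [((hφ.hasFDerivAt hw).pow 2).fderiv]
  simp
  ring

lemma minkowskiTensor_comm (hφ : IsMinkowskiNorm φ) (hw : w ≠ 0) (u v : E n) :
    minkowskiTensor φ w u v = minkowskiTensor φ w v u := by
  have h := (hφ.contDiffAt_sq hw).isSymmSndFDerivAt
    (by simp; exact WithTop.coe_le_coe.2 le_top) u v
  simp [minkowskiTensor, h]

lemma fderiv_sq_smul (hφ : IsMinkowskiNorm φ) {c : ℝ} (hc : 0 < c) (hw : w ≠ 0) :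
    fderiv ℝ (fun v => φ v ^ 2) (c • w) = c • fderiv ℝ (fun v => φ v ^ 2) w := by
  have h1 := (hφ.hasFDerivAt_sq (smul_ne_zero hc.ne' hw)).comp w
    ((hasFDerivAt_id (𝕜 := ℝ) w).const_smul c)
  have h2 := (hφ.hasFDerivAt_sq hw).const_mul (c ^ 2)
  have h3 := h2.congr_of_eventuallyEq (f₁ := (fun v => φ v ^ 2) ∘ fun v => c • id v)
    (.of_forall fun v => by simp [hφ.homogeneous c hc, mul_pow])
  ext v
  have := congrArg (fun T : E n →L[ℝ] ℝ => T v) (h1.unique h3)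
  simp at this
  apply mul_left_cancel₀ hc.ne'
  simp only [_root_.smul_apply, smul_eq_mul]
  rw [this]
  ring

/-- Euler's relation for `D(φ²)`, which is positively homogeneous of degree one. -/
lemma minkowskiTensor_self_left (hφ : IsMinkowskiNorm φ) (hw : w ≠ 0) (v : E n) :
    minkowskiTensor φ w w v = φ w * fderiv ℝ φ w v := by
  have h1 := (show HasFDerivAt _ _ ((1 : ℝ) • w) by
    rw [one_smul]; exact hφ.hasFDerivAt_fderiv_sq hw).comp_hasDerivAt (1 : ℝ)
    ((hasDerivAt_id (1 : ℝ)).smul_const w)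
  have h2 := (hasDerivAt_id (1 : ℝ)).smul_const (fderiv ℝ (fun v => φ v ^ 2) w)
  have h3 := h2.congr_of_eventuallyEq
    (f₁ := (fderiv ℝ fun v => φ v ^ 2) ∘ fun t : ℝ => id t • w)
    (by filter_upwards [lt_mem_nhds one_pos] with t ht using hφ.fderiv_sq_smul ht hw)
  have := congrArg (fun T : E n →L[ℝ] ℝ => T v) (h1.unique h3)
  simp [hφ.fderiv_sq hw] at this
  linarith

/-- Euler's relation for `φ`. -/
lemma fderiv_self (hφ : IsMinkowskiNorm φ) (hw : w ≠ 0) : fderiv ℝ φ w w = φ w := by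
  have h1 := (show HasFDerivAt φ _ ((1 : ℝ) • w) by
    rw [one_smul]; exact hφ.hasFDerivAt hw).comp_hasDerivAt (1 : ℝ)
    ((hasDerivAt_id (1 : ℝ)).smul_const w)
  have h2 := (hasDerivAt_id (1 : ℝ)).mul_const (φ w)
  have h3 := h2.congr_of_eventuallyEq (f₁ := φ ∘ fun t : ℝ => id t • w)
    (by filter_upwards [lt_mem_nhds one_pos] with t ht using hφ.homogeneous t ht w)
  simpa using h1.unique h3

lemma minkowskiTensor_self_self (hφ : IsMinkowskiNorm φ) (hw : w ≠ 0) :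
    minkowskiTensor φ w w w = φ w ^ 2 := by
  rw [hφ.minkowskiTensor_self_left hw, hφ.fderiv_self hw, sq]

end IsMinkowskiNorm

/-! ### Invariant Finsler functions in a Maurer–Cartan frame -/

/-- The bilinear form `½ D²(φ²)` at `A y`, pulled back by `A`. -/
def pullbackTensor (φ : E n → ℝ) (A : E n →L[ℝ] E n) (y : E n) : E n →L[ℝ] E n →L[ℝ] ℝ :=
  (ContinuousLinearMap.compL ℝ (E n) (E n) ℝ).flip A ∘L (minkowskiTensor φ (A y) ∘L A)

@[simp] lemma pullbackTensor_apply (φ : E n → ℝ) (A : E n →L[ℝ] E n) (y u v : E n) :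
    pullbackTensor φ A y u v = minkowskiTensor φ (A y) (A u) (A v) := rfl

lemma sum_sum_mul_apply_single (B : E n →L[ℝ] E n →L[ℝ] ℝ) (u v : E n) :
    ∑ j, ∑ k, u j * v k * B (EuclideanSpace.single j 1) (EuclideanSpace.single k 1) = B u v := by
  have : B u v = B.flip v u := rfl
  rw [this, ← sum_mul_apply_single]
  refine Finset.sum_congr rfl fun j _ => ?_
  rw [ContinuousLinearMap.flip_apply, ← sum_mul_apply_single, Finset.mul_sum]
  exact Finset.sum_congr rfl fun k _ => by ring

namespace IsMaurerCartanFrame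

variable {br : E n →L[ℝ] E n →L[ℝ] E n} {U : Set (E n)} {A : E n → E n →L[ℝ] E n} {S : E n → E n}
  {φ : E n → ℝ} {F : E n → E n → ℝ}

section Metric

variable (hA : IsMaurerCartanFrame br U A) (hφ : IsMinkowskiNorm φ)
  (hF : ∀ x ∈ U, ∀ y, F x y = φ (A x y)) {x y : E n}
include hA hφ hF

lemma dy_eq (hx : x ∈ U) (hy : y ≠ 0) (k : Fin n) :
    dy k F x y = fderiv ℝ φ (A x y) (A x (EuclideanSpace.single k 1)) := by
  have h := (hφ.hasFDerivAt (hA.apply_ne_zero hx hy)).comp y (A x).hasFDerivAt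
  have he : F x = φ ∘ A x := funext fun y => hF x hx y
  rw [dy, he, h.fderiv]
  rfl

lemma fundamentalTensor_eq (hx : x ∈ U) (hy : y ≠ 0) (i j : Fin n) :
    fundamentalTensor F i j x y =
      pullbackTensor φ (A x) y (EuclideanSpace.single j 1) (EuclideanSpace.single i 1) := by
  have h1 : ∀ y', y' ≠ 0 → dy i (fun x' y' => F x' y' ^ 2) x y' =
      fderiv ℝ (fun v => φ v ^ 2) (A x y') (A x (EuclideanSpace.single i 1)) := by
    intro y' hy'
    have h := (hφ.hasFDerivAt_sq (hA.apply_ne_zero hx hy')).comp y' (A x).hasFDerivAt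
    have he : (fun y' => F x y' ^ 2) = (fun v => φ v ^ 2) ∘ A x := funext fun y => by
      simp [hF x hx y]
    rw [dy, he, h.fderiv]
    rfl
  have h2 := ((hφ.hasFDerivAt_fderiv_sq (hA.apply_ne_zero hx hy)).comp y
    (A x).hasFDerivAt).clm_apply (hasFDerivAt_const (A x (EuclideanSpace.single i 1)) y)
  have h3 := h2.congr_of_eventuallyEq (f₁ := fun y' => dy i (fun x' y' => F x' y' ^ 2) x y')
    (by filter_upwards [eventually_ne_zero hy] with y' hy' using h1 y' hy')
  rw [fundamentalTensor, dy, h3.fderiv]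
  simp

lemma fundamentalForm_eq (hx : x ∈ U) (hy : y ≠ 0) (u v : E n) :
    fundamentalForm F x y u v = pullbackTensor φ (A x) y u v := by
  rw [pullbackTensor_apply, hφ.minkowskiTensor_comm (hA.apply_ne_zero hx hy),
    ← pullbackTensor_apply, ← sum_sum_mul_apply_single, fundamentalForm, Finset.sum_comm]
  refine Finset.sum_congr rfl fun j _ => Finset.sum_congr rfl fun i _ => ?_
  rw [hA.fundamentalTensor_eq hφ hF hx hy]
  ring

lemma posDef_fundamentalMatrix (hx : x ∈ U) (hy : y ≠ 0) : (fundamentalMatrix F x y).PosDef := by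
  have hw := hA.apply_ne_zero hx hy
  refine Matrix.PosDef.of_dotProduct_mulVec_pos ?_ fun v hv => ?_
  · ext i j
    simp only [fundamentalMatrix, Matrix.conjTranspose_apply, Matrix.of_apply, star_trivial,
      hA.fundamentalTensor_eq hφ hF hx hy, pullbackTensor_apply]
    exact hφ.minkowskiTensor_comm hw _ _
  · have h : dotProduct (star v) ((fundamentalMatrix F x y).mulVec v) =
        fundamentalForm F x y (WithLp.toLp 2 v) (WithLp.toLp 2 v) := by
      simp only [dotProduct, Matrix.mulVec, fundamentalForm, fundamentalMatrix, Matrix.of_apply,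
        Finset.mul_sum, Pi.star_apply, star_trivial]
      exact Finset.sum_congr rfl fun i _ => Finset.sum_congr rfl fun j _ => by ring
    rw [h, hA.fundamentalForm_eq hφ hF hx hy]
    exact hφ.posDef _ hw _ (hA.apply_ne_zero hx (by simpa using hv))

omit hF in
lemma differentiableAt_pullbackTensor (hx : x ∈ U) (hy : y ≠ 0) :
    DifferentiableAt ℝ (fun x' => pullbackTensor φ (A x') y) x := by
  have hd := (hA.contDiffAt hx).differentiableAt (by simp)
  have hT : DifferentiableAt ℝ (fun x' => minkowskiTensor φ (A x' y)) x :=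
    DifferentiableAt.comp (f := fun x' => A x' y) x ((hφ.contDiffAt_minkowskiTensor
      (hA.apply_ne_zero hx hy)).differentiableAt (by simp))
      (hd.clm_apply (differentiableAt_const y))
  exact (DifferentiableAt.comp x
    (ContinuousLinearMap.compL ℝ (E n) (E n) ℝ).flip.differentiableAt hd).clm_comp (hT.clm_comp hd)

lemma dx_fundamentalTensor_eq (hx : x ∈ U) (hy : y ≠ 0) (i j k : Fin n) :
    dx k (fundamentalTensor F i j) x y = fderiv ℝ (fun x' => pullbackTensor φ (A x') y) x
      (EuclideanSpace.single k 1) (EuclideanSpace.single j 1) (EuclideanSpace.single i 1) := by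
  have hd := hA.differentiableAt_pullbackTensor hφ hx hy
  have h : (fun x' => fundamentalTensor F i j x' y) =ᶠ[𝓝 x] fun x' =>
      pullbackTensor φ (A x') y (EuclideanSpace.single j 1) (EuclideanSpace.single i 1) := by
    filter_upwards [hA.isOpen.mem_nhds hx] with x' hx'
      using hA.fundamentalTensor_eq hφ hF hx' hy i j
  rw [dx, h.fderiv_eq, fderiv_clm_apply_const (hasFDerivAt_clm_apply_const hd _).differentiableAt,
    fderiv_clm_apply_const hd]

omit hF in
/-- By Euler's relation, differentiating `g(y, v)` in the base variable needs no third derivative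
of `φ²`. -/
lemma fderiv_pullbackTensor_self_left (hx : x ∈ U) (hy : y ≠ 0) (u v : E n) :
    fderiv ℝ (fun x' => pullbackTensor φ (A x') y) x u y v =
      minkowskiTensor φ (A x y) (fderiv ℝ A x u y) (A x v)
        + 1 / 2 * fderiv ℝ (fun v => φ v ^ 2) (A x y) (fderiv ℝ A x u v) := by
  have hd := hA.differentiableAt_pullbackTensor hφ hx hy
  have hd1 := ((hA.contDiffAt hx).differentiableAt (by simp)).hasFDerivAt
  have h1 := (((hφ.hasFDerivAt_fderiv_sq (hA.apply_ne_zero hx hy)).comp x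
    (hd1.clm_apply (hasFDerivAt_const y x))).clm_apply
      (hd1.clm_apply (hasFDerivAt_const v x))).const_mul (1 / 2 : ℝ)
  have h2 := h1.congr_of_eventuallyEq (f₁ := fun x' => pullbackTensor φ (A x') y y v)
    (by filter_upwards [hA.isOpen.mem_nhds hx] with x' hx'
        have hw := hA.apply_ne_zero hx' hy
        simp [hφ.minkowskiTensor_self_left hw, hφ.fderiv_sq hw])
  rw [← fderiv_clm_apply_const hd,
    ← fderiv_clm_apply_const (hasFDerivAt_clm_apply_const hd _).differentiableAt, h2.fderiv]
  simp
  ring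

/-- The spray of an invariant Finsler function: the Euler–Lagrange equations become `w' = -S(w)`
for the velocity `w` in the frame, where `S` is dual to `z ↦ ½ D(φ²)[w, z]`. -/
lemma sprayCoeff_eq (hS : ∀ w, w ≠ 0 → ∀ z, minkowskiTensor φ w (S w) z =
      1 / 2 * fderiv ℝ (fun v => φ v ^ 2) w (br w z))
    (hx : x ∈ U) (hy : y ≠ 0) (i : Fin n) :
    sprayCoeff F i x y = frameSpray A S x y i := by
  have hw := hA.apply_ne_zero hx hy
  have hd := hA.differentiableAt_pullbackTensor hφ hx hy
  set D := fderiv ℝ (fun x' => pullbackTensor φ (A x') y) x with hD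
  have hsymm : ∀ u v z, D u v z = D u z v := by
    intro u v z
    rw [hD, ← fderiv_clm_apply_const hd, ← fderiv_clm_apply_const hd,
      ← fderiv_clm_apply_const (hasFDerivAt_clm_apply_const hd _).differentiableAt,
      ← fderiv_clm_apply_const (hasFDerivAt_clm_apply_const hd _).differentiableAt]
    congr 1
    apply Filter.EventuallyEq.fderiv_eq
    filter_upwards [hA.isOpen.mem_nhds hx] with x' hx'
    exact hφ.minkowskiTensor_comm (hA.apply_ne_zero hx' hy) _ _
  -- the covector `½ (∂_k g_lj - ∂_l g_jk + ∂_j g_kl) yʲ yᵏ / 2` is `g(G, ·)`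
  have hc : ∀ l, 1 / 2 * ∑ j, ∑ k, y j * y k *
      (1 / 2 * (dx k (fundamentalTensor F l j) x y - dx l (fundamentalTensor F j k) x y
        + dx j (fundamentalTensor F k l) x y)) =
      (fundamentalMatrix F x y).mulVec (frameSpray A S x y) l := by
    intro l
    set e := fun m : Fin n => EuclideanSpace.single m (1 : ℝ)
    have h1 : ∀ j k, dx k (fundamentalTensor F l j) x y - dx l (fundamentalTensor F j k) x y
        + dx j (fundamentalTensor F k l) x y =
        D.flip (e j) (e k) (e l) - D (e l) (e j) (e k) + D (e j) (e k) (e l) := by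
      intro j k
      rw [hA.dx_fundamentalTensor_eq hφ hF hx hy, hA.dx_fundamentalTensor_eq hφ hF hx hy,
        hA.dx_fundamentalTensor_eq hφ hF hx hy, ← hD, hsymm _ (e k) (e j), hsymm _ (e l) (e k)]
      rfl
    have h2 : ∑ j, ∑ k, y j * y k *
        (1 / 2 * (dx k (fundamentalTensor F l j) x y - dx l (fundamentalTensor F j k) x y
        + dx j (fundamentalTensor F k l) x y)) =
        1 / 2 * (2 * D y y (e l) - D (e l) y y) := by
      have s1 := sum_sum_mul_apply_single
        ((ContinuousLinearMap.compL ℝ (E n) (E n →L[ℝ] ℝ) ℝ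
          (ContinuousLinearMap.apply ℝ ℝ (e l))) ∘L D) y y
      have s2 := sum_sum_mul_apply_single (D (e l)) y y
      have s3 := sum_sum_mul_apply_single
        ((ContinuousLinearMap.compL ℝ (E n) (E n →L[ℝ] ℝ) ℝ
          (ContinuousLinearMap.apply ℝ ℝ (e l))) ∘L D.flip) y y
      simp only [ContinuousLinearMap.comp_apply, ContinuousLinearMap.compL_apply,
        ContinuousLinearMap.apply_apply, ContinuousLinearMap.flip_apply] at s1 s3
      simp only [h1, ContinuousLinearMap.flip_apply]
      calc _ = 1 / 2 * ((∑ j, ∑ k, y j * y k * D (e k) (e j) (e l))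
            - (∑ j, ∑ k, y j * y k * D (e l) (e j) (e k))
            + ∑ j, ∑ k, y j * y k * D (e j) (e k) (e l)) := by
            simp only [← Finset.sum_sub_distrib, ← Finset.sum_add_distrib, Finset.mul_sum]
            exact Finset.sum_congr rfl fun j _ => Finset.sum_congr rfl fun k _ => by ring
        _ = _ := by rw [s1, s2, s3]; ring
    have h3 : (fundamentalMatrix F x y).mulVec (frameSpray A S x y) l =
        minkowskiTensor φ (A x y) (A x (frameSpray A S x y)) (A x (e l)) := by
      rw [← pullbackTensor_apply, ← ContinuousLinearMap.flip_apply, ← sum_mul_apply_single]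
      simp only [Matrix.mulVec, dotProduct, fundamentalMatrix, Matrix.of_apply,
        hA.fundamentalTensor_eq hφ hF hx hy]
      exact Finset.sum_congr rfl fun j _ => mul_comm _ _
    have h4 : A x (frameSpray A S x y) = (1 / 2 : ℝ) • (fderiv ℝ A x y y + S (A x y)) := by
      rw [← hA.apply_frameSpray hx]; module
    have h5 : fderiv ℝ A x y (e l) = fderiv ℝ A x (e l) y + br (A x y) (A x (e l)) := by
      rw [← hA.structure_eq x hx]; abel
    have h6 : minkowskiTensor φ (A x y) (fderiv ℝ A x (e l) y) (A x y) =
        1 / 2 * fderiv ℝ (fun v => φ v ^ 2) (A x y) (fderiv ℝ A x (e l) y) := by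
      rw [hφ.minkowskiTensor_comm hw, hφ.minkowskiTensor_self_left hw, hφ.fderiv_sq hw]; ring
    rw [h2, h3, h4, hA.fderiv_pullbackTensor_self_left hφ hx hy,
      hA.fderiv_pullbackTensor_self_left hφ hx hy, h5, h6]
    simp only [map_smul, map_add, _root_.smul_apply, _root_.add_apply, hS _ hw, smul_eq_mul]
    ring
  have hdet : IsUnit (fundamentalMatrix F x y).det :=
    (hA.posDef_fundamentalMatrix hφ hF hx hy).isUnit.map Matrix.detMonoidHom
  have hinv : (frameSpray A S x y) i = ((fundamentalMatrix F x y)⁻¹.mulVec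
      ((fundamentalMatrix F x y).mulVec (frameSpray A S x y))) i := by
    rw [Matrix.mulVec_mulVec, Matrix.nonsing_inv_mul _ hdet, Matrix.one_mulVec]
  rw [hinv, Matrix.mulVec, dotProduct]
  simp only [← hc, sprayCoeff, christoffel, Finset.mul_sum, Finset.sum_mul]
  conv_rhs => rw [Finset.sum_comm]
  refine Finset.sum_congr rfl fun j _ => ?_
  conv_rhs => rw [Finset.sum_comm]
  exact Finset.sum_congr rfl fun k _ => Finset.sum_congr rfl fun l _ => by ring

end Metric

end IsMaurerCartanFrame

/-! ### The Randers norm on the Lie algebra of imaginary quaternions -/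

lemma eq_of_forall_fin_three {u v : E 3} (h0 : u 0 = v 0) (h1 : u 1 = v 1) (h2 : u 2 = v 2) :
    u = v := by
  ext i
  fin_cases i <;> assumption

/-- The commutator bracket `[u, v] = 2 u × v` of imaginary quaternions. -/
def imBracket : E 3 →L[ℝ] E 3 →L[ℝ] E 3 :=
  (LinearMap.mk₂ ℝ (fun u v : E 3 => (!₂[2 * (u 1 * v 2 - u 2 * v 1),
      2 * (u 2 * v 0 - u 0 * v 2), 2 * (u 0 * v 1 - u 1 * v 0)] : E 3))
    (fun _ _ _ => by apply eq_of_forall_fin_three <;> simp <;> ring)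
    (fun _ _ _ => by apply eq_of_forall_fin_three <;> simp <;> ring)
    (fun _ _ _ => by apply eq_of_forall_fin_three <;> simp <;> ring)
    (fun _ _ _ => by apply eq_of_forall_fin_three <;> simp <;> ring)).toContinuousBilinearMap

@[simp] lemma imBracket_zero (u v : E 3) : imBracket u v 0 = 2 * (u 1 * v 2 - u 2 * v 1) := rfl
@[simp] lemma imBracket_one (u v : E 3) : imBracket u v 1 = 2 * (u 2 * v 0 - u 0 * v 2) := rfl
@[simp] lemma imBracket_two (u v : E 3) : imBracket u v 2 = 2 * (u 0 * v 1 - u 1 * v 0) := rfl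

/-- The first basis vector, the quaternion `i`. -/
abbrev axis : E 3 := EuclideanSpace.single 0 1

/-- The Randers norm `√((1 + s²) w₀² + w₁² + w₂²) + s w₀`. -/
def randersNorm (s : ℝ) (w : E 3) : ℝ :=
  Real.sqrt ((1 + s ^ 2) * w 0 ^ 2 + w 1 ^ 2 + w 2 ^ 2) + s * w 0

/-- The vector field `S` of the geodesic equation `w' = -S(w)` of the invariant Finsler metric with
norm `randersNorm s`: unit-speed velocities rotate uniformly about the axis `i`. -/
def randersSpray (s : ℝ) (w : E 3) : E 3 := (s * randersNorm s w) • imBracket axis w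

variable {s : ℝ} {w : E 3}

lemma quadratic_pos (s : ℝ) (hw : w ≠ 0) : 0 < (1 + s ^ 2) * w 0 ^ 2 + w 1 ^ 2 + w 2 ^ 2 := by
  by_contra! h
  have hs : 0 ≤ s ^ 2 * w 0 ^ 2 := by positivity
  have h0 : w 0 = 0 := by nlinarith [sq_nonneg (w 0), sq_nonneg (w 1), sq_nonneg (w 2)]
  have h1 : w 1 = 0 := by nlinarith [sq_nonneg (w 0), sq_nonneg (w 1), sq_nonneg (w 2)]
  have h2 : w 2 = 0 := by nlinarith [sq_nonneg (w 0), sq_nonneg (w 1), sq_nonneg (w 2)]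
  exact hw (eq_of_forall_fin_three h0 h1 h2)

lemma randersNorm_sub_pos (s : ℝ) (hw : w ≠ 0) : 0 < randersNorm s w - s * w 0 := by
  simpa [randersNorm] using quadratic_pos s hw

lemma randersNorm_sub_sq (s : ℝ) (w : E 3) :
    (randersNorm s w - s * w 0) ^ 2 = (1 + s ^ 2) * w 0 ^ 2 + w 1 ^ 2 + w 2 ^ 2 := by
  rw [randersNorm, add_sub_cancel_right, Real.sq_sqrt]
  positivity

/-- The quadratic equation satisfied by the Randers norm. Differentiating it replaces computations
with square roots by polynomial identities. -/
lemma randersNorm_sq (s : ℝ) (w : E 3) :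
    randersNorm s w ^ 2 - 2 * s * w 0 * randersNorm s w = w 0 ^ 2 + w 1 ^ 2 + w 2 ^ 2 := by
  linear_combination randersNorm_sub_sq s w

lemma randersNorm_pos (s : ℝ) (hw : w ≠ 0) : 0 < randersNorm s w := by
  have h1 := randersNorm_sub_pos s hw
  have h2 := randersNorm_sub_sq s w
  by_contra! h
  have h3 : (randersNorm s w - s * w 0) ^ 2 ≤ (s * w 0) ^ 2 := by nlinarith
  have h5 := quadratic_pos s hw
  have h0 : w 0 = 0 := by nlinarith [sq_nonneg (w 0), sq_nonneg (w 1), sq_nonneg (w 2)]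
  rw [h0] at h1
  linarith

lemma contDiffAt_randersNorm (s : ℝ) (hw : w ≠ 0) : ContDiffAt ℝ ∞ (randersNorm s) w := by
  have h : ContDiff ℝ ∞ fun w : E 3 => (1 + s ^ 2) * w 0 ^ 2 + w 1 ^ 2 + w 2 ^ 2 := by fun_prop
  exact (h.contDiffAt.sqrt (quadratic_pos s hw).ne').add (by fun_prop)

lemma hasFDerivAt_randersNorm (s : ℝ) (hw : w ≠ 0) :
    HasFDerivAt (randersNorm s) (fderiv ℝ (randersNorm s) w) w :=
  ((contDiffAt_randersNorm s hw).differentiableAt (by simp)).hasFDerivAt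

lemma hasFDerivAt_fderiv_randersNorm (s : ℝ) (hw : w ≠ 0) :
    HasFDerivAt (fderiv ℝ (randersNorm s)) (fderiv ℝ (fderiv ℝ (randersNorm s)) w) w :=
  (((contDiffAt_randersNorm s hw).fderiv_right (m := ∞) (by simp)).differentiableAt
    (by simp)).hasFDerivAt

lemma hasFDerivAt_coord (i : Fin 3) (w : E 3) :
    HasFDerivAt (fun w : E 3 => w i) (EuclideanSpace.proj (𝕜 := ℝ) i : E 3 →L[ℝ] ℝ) w :=
  (EuclideanSpace.proj (𝕜 := ℝ) i).hasFDerivAt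

lemma fderiv_randersNorm (s : ℝ) (hw : w ≠ 0) (z : E 3) :
    (randersNorm s w - s * w 0) * fderiv ℝ (randersNorm s) w z =
      w 0 * z 0 + w 1 * z 1 + w 2 * z 2 + s * randersNorm s w * z 0 := by
  have hd := hasFDerivAt_randersNorm s hw
  have h0 := hasFDerivAt_coord 0 w
  have h1 := hasFDerivAt_coord 1 w
  have h2 := hasFDerivAt_coord 2 w
  have hl := (hd.pow 2).sub ((h0.const_mul (2 * s)).mul hd)
  have hr := ((h0.pow 2).add (h1.pow 2)).add (h2.pow 2)
  have := congrArg (fun T : E 3 →L[ℝ] ℝ => T z)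
    (hl.unique (hr.congr_of_eventuallyEq (.of_forall fun w' => randersNorm_sq s w')))
  simp at this
  linear_combination (1 / 2) * this

lemma fderiv_fderiv_randersNorm (s : ℝ) (hw : w ≠ 0) (u v : E 3) :
    (randersNorm s w - s * w 0) * fderiv ℝ (fderiv ℝ (randersNorm s)) w u v =
      u 0 * v 0 + u 1 * v 1 + u 2 * v 2 + s * fderiv ℝ (randersNorm s) w u * v 0
        + s * u 0 * fderiv ℝ (randersNorm s) w v
        - fderiv ℝ (randersNorm s) w u * fderiv ℝ (randersNorm s) w v := by
  have hd := hasFDerivAt_randersNorm s hw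
  have hdd := (hasFDerivAt_fderiv_randersNorm s hw).clm_apply (hasFDerivAt_const v w)
  have h0 := hasFDerivAt_coord 0 w
  have h1 := hasFDerivAt_coord 1 w
  have h2 := hasFDerivAt_coord 2 w
  have hl := (hd.sub (h0.const_mul s)).mul hdd
  have hr := (((h0.mul_const (v 0)).add (h1.mul_const (v 1))).add (h2.mul_const (v 2))).add
    ((hd.const_mul s).mul_const (v 0))
  have := congrArg (fun T : E 3 →L[ℝ] ℝ => T u) (hl.unique (hr.congr_of_eventuallyEq
    (by filter_upwards [eventually_ne_zero hw] with w' hw' using fderiv_randersNorm s hw' v)))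
  simp at this
  linear_combination this

lemma minkowskiTensor_randersNorm_pos (s : ℝ) (hw : w ≠ 0) {v : E 3} (hv : v ≠ 0) :
    0 < minkowskiTensor (randersNorm s) w v v := by
  rw [minkowskiTensor_apply (contDiffAt_randersNorm s hw)]
  have ha := randersNorm_sub_pos s hw
  have hφ := randersNorm_pos s hw
  have e1 := fderiv_randersNorm s hw v
  have e2 := fderiv_fderiv_randersNorm s hw v v
  have e3 := randersNorm_sub_sq s w
  have e4 := randersNorm_sq s w
  generalize fderiv ℝ (fderiv ℝ (randersNorm s)) w v v = d at *
  generalize fderiv ℝ (randersNorm s) w v = p at *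
  generalize randersNorm s w = φ at *
  obtain ⟨a, rfl⟩ : ∃ a, φ = a + s * w 0 := ⟨φ - s * w 0, by ring⟩
  rw [add_sub_cancel_right] at ha e1 e2 e3
  -- the Cauchy–Schwarz defect of the Riemannian part, by Lagrange's identity
  have e5 : a ^ 2 * (a * d) = (1 + s ^ 2) * ((w 0 * v 1 - w 1 * v 0) ^ 2
      + (w 0 * v 2 - w 2 * v 0) ^ 2) + (w 1 * v 2 - w 2 * v 1) ^ 2 := by
    have e1' : a * (p - s * v 0) = (1 + s ^ 2) * w 0 * v 0 + w 1 * v 1 + w 2 * v 2 := by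
      linear_combination e1
    have e2' : a * d = (1 + s ^ 2) * v 0 ^ 2 + v 1 ^ 2 + v 2 ^ 2 - (p - s * v 0) ^ 2 := by
      linear_combination e2
    rw [e2', mul_sub, ← mul_pow, e1', e3]
    ring
  have hd : 0 ≤ d := by
    have : 0 ≤ a ^ 2 * (a * d) := by rw [e5]; positivity
    exact nonneg_of_mul_nonneg_right (nonneg_of_mul_nonneg_right this (by positivity)) ha
  by_contra! h
  have hdφ := mul_nonneg hφ.le hd
  have hp : p = 0 := by nlinarith
  have hd0 : d = 0 := by
    have : (a + s * w 0) * d = 0 := by nlinarith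
    exact (mul_eq_zero.1 this).resolve_left hφ.ne'
  rw [hd0, mul_zero, mul_zero] at e5
  obtain ⟨q12, q3⟩ := (add_eq_zero_iff_of_nonneg (by positivity) (by positivity)).1 e5.symm
  obtain ⟨q1, q2⟩ := (add_eq_zero_iff_of_nonneg (sq_nonneg _) (sq_nonneg _)).1
    ((mul_eq_zero.1 q12).resolve_left (by positivity))
  rw [sq_eq_zero_iff] at q1 q2 q3
  -- `v` is parallel to `w`, so `p w = φ v`
  have hne : (a + s * w 0) * a ≠ 0 := (mul_pos hφ ha).ne'
  rw [hp] at e1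
  refine hv (eq_of_forall_fin_three ?_ ?_ ?_)
  · apply (mul_eq_zero.1 (?_ : (a + s * w 0) * a * v 0 = 0)).resolve_left hne
    linear_combination v 0 * e4 - w 0 * e1 - w 1 * q1 - w 2 * q2
  · apply (mul_eq_zero.1 (?_ : (a + s * w 0) * a * v 1 = 0)).resolve_left hne
    linear_combination v 1 * e4 - w 1 * e1 + w 0 * q1 - w 2 * q3 + s * (a + s * w 0) * q1
  · apply (mul_eq_zero.1 (?_ : (a + s * w 0) * a * v 2 = 0)).resolve_left hne
    linear_combination v 2 * e4 - w 2 * e1 + w 0 * q2 + w 1 * q3 + s * (a + s * w 0) * q2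

lemma isMinkowskiNorm_randersNorm (s : ℝ) : IsMinkowskiNorm (randersNorm s) where
  contDiffOn w hw := (contDiffAt_randersNorm s hw).contDiffWithinAt
  pos w hw := randersNorm_pos s hw
  homogeneous c hc w := by
    have : (1 + s ^ 2) * (c * w 0) ^ 2 + (c * w 1) ^ 2 + (c * w 2) ^ 2 =
        c ^ 2 * ((1 + s ^ 2) * w 0 ^ 2 + w 1 ^ 2 + w 2 ^ 2) := by ring
    simp only [randersNorm, PiLp.smul_apply, smul_eq_mul, this]
    rw [Real.sqrt_mul (sq_nonneg c), Real.sqrt_sq hc.le]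
    ring
  posDef w hw v hv := minkowskiTensor_randersNorm_pos s hw hv

/-- The Randers norm is invariant under rotations about the axis. -/
lemma fderiv_randersNorm_rotation (s : ℝ) (hw : w ≠ 0) :
    fderiv ℝ (randersNorm s) w (imBracket axis w) = 0 := by
  have h := fderiv_randersNorm s hw (imBracket axis w)
  apply (mul_eq_zero.1 (h.trans ?_)).resolve_left (randersNorm_sub_pos s hw).ne'
  simp
  ring

lemma fderiv_fderiv_randersNorm_rotation (s : ℝ) (hw : w ≠ 0) (z : E 3) :
    (randersNorm s w - s * w 0) * fderiv ℝ (fderiv ℝ (randersNorm s)) w z (imBracket axis w) =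
      2 * (w 1 * z 2 - w 2 * z 1) := by
  rw [fderiv_fderiv_randersNorm s hw, fderiv_randersNorm_rotation s hw]
  simp
  ring

/-- The Euler–Lagrange equation: `randersSpray` is dual to `z ↦ ½ D(φ²)[w, z]`. -/
lemma minkowskiTensor_randersSpray (s : ℝ) (w : E 3) (hw : w ≠ 0) (z : E 3) :
    minkowskiTensor (randersNorm s) w (randersSpray s w) z =
      1 / 2 * fderiv ℝ (fun v => randersNorm s v ^ 2) w (imBracket w z) := by
  have hM := isMinkowskiNorm_randersNorm s
  rw [hM.minkowskiTensor_comm hw, minkowskiTensor_apply (hM.contDiffAt hw), hM.fderiv_sq hw]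
  have e1 := fderiv_fderiv_randersNorm_rotation s hw z
  have e2 := fderiv_randersNorm s hw (imBracket w z)
  simp only [randersSpray, map_smul, fderiv_randersNorm_rotation s hw, smul_eq_mul,
    imBracket_zero, imBracket_one, imBracket_two] at e2 ⊢
  apply mul_left_cancel₀ (randersNorm_sub_pos s hw).ne'
  linear_combination s * randersNorm s w ^ 2 * e1 - randersNorm s w * e2

lemma contDiffOn_randersSpray (s : ℝ) : ContDiffOn ℝ ∞ (randersSpray s) {0}ᶜ := fun _ hw =>
  ((contDiffAt_const.mul (contDiffAt_randersNorm s hw)).smul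
    (imBracket axis).contDiff.contDiffAt).contDiffWithinAt

lemma fderiv_randersSpray (s : ℝ) (hw : w ≠ 0) (z : E 3) :
    fderiv ℝ (randersSpray s) w z = (s * fderiv ℝ (randersNorm s) w z) • imBracket axis w
      + (s * randersNorm s w) • imBracket axis z := by
  have h : HasFDerivAt (randersSpray s) _ w :=
    ((hasFDerivAt_randersNorm s hw).const_mul s).smul (imBracket axis).hasFDerivAt
  rw [h.fderiv]
  simp [add_comm]

lemma fderiv_fderiv_randersSpray (s : ℝ) (hw : w ≠ 0) (u v : E 3) :
    fderiv ℝ (fderiv ℝ (randersSpray s)) w u v =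
      (s * fderiv ℝ (fderiv ℝ (randersNorm s)) w u v) • imBracket axis w
        + (s * fderiv ℝ (randersNorm s) w v) • imBracket axis u
        + (s * fderiv ℝ (randersNorm s) w u) • imBracket axis v := by
  have hd : DifferentiableAt ℝ (fderiv ℝ (randersSpray s)) w :=
    (((contDiffOn_randersSpray s).contDiffAt (isOpen_compl_singleton.mem_nhds hw)).fderiv_right
      (m := ∞) (by simp)).differentiableAt (by simp)
  have h := (((((hasFDerivAt_fderiv_randersNorm s hw).clm_apply
    (hasFDerivAt_const v w)).const_mul s).smul (imBracket axis).hasFDerivAt).add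
    (((hasFDerivAt_randersNorm s hw).const_mul s).smul_const
      (imBracket axis v))).congr_of_eventuallyEq (f₁ := fun w' => fderiv ℝ (randersSpray s) w' v)
    (by filter_upwards [eventually_ne_zero hw] with w' hw' using fderiv_randersSpray s hw' v)
  rw [← fderiv_clm_apply_const hd, h.fderiv]
  simp
  abel

/-- The invariant spray of the Randers norm has constant curvature `1 + s²`. -/
lemma invariantCurvature_randersSpray (s : ℝ) (hw : w ≠ 0) (z : E 3) :
    invariantCurvature imBracket (randersSpray s) w z = ((1 + s ^ 2) * randersNorm s w) •
      (randersNorm s w • z - fderiv ℝ (randersNorm s) w z • w) := by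
  have ha := (randersNorm_sub_pos s hw).ne'
  have e0 := fderiv_randersNorm_rotation s hw
  have e1 := randersNorm_sq s w
  have e2 := fderiv_randersNorm s hw z
  have er := fderiv_fderiv_randersNorm_rotation s hw z
  -- the derivative of the rotation invariance of the norm
  have e3 : fderiv ℝ (randersNorm s) w (imBracket axis z) =
      - fderiv ℝ (fderiv ℝ (randersNorm s)) w z (imBracket axis w) := by
    apply mul_left_cancel₀ ha
    rw [mul_neg, er, fderiv_randersNorm s hw]
    simp
    ring
  -- `w` is orthogonal to `[w, z]`, so only the Randers term contributes
  have e4 : fderiv ℝ (randersNorm s) w (imBracket w z) =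
      s * randersNorm s w * fderiv ℝ (fderiv ℝ (randersNorm s)) w z (imBracket axis w) := by
    apply mul_left_cancel₀ ha
    rw [mul_left_comm, er, fderiv_randersNorm s hw]
    simp
    ring
  simp only [invariantCurvature, fderiv_randersSpray s hw, fderiv_fderiv_randersSpray s hw,
    randersSpray, map_sub, map_add, map_smul, _root_.smul_apply, e0, e3, e4, smul_eq_mul]
  generalize fderiv ℝ (fderiv ℝ (randersNorm s)) w z (imBracket axis w) = r at *
  generalize fderiv ℝ (randersNorm s) w z = p at *
  generalize randersNorm s w = φ at *
  apply eq_of_forall_fin_three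
  · simp
    linear_combination (-z 0 - s * p) * e1 + (w 0 + s * φ) * e2
  · simp
    linear_combination (-z 1) * e1 + (w 1) * e2
  · simp
    linear_combination (-z 2) * e1 + (w 2) * e2

/-! ### Constant flag curvature in a Maurer–Cartan frame -/

namespace IsMaurerCartanFrame

section

variable {br : E n →L[ℝ] E n →L[ℝ] E n} {U : Set (E n)} {A : E n → E n →L[ℝ] E n}
  {φ : E n → ℝ} {F : E n → E n → ℝ}

/-- The spray curvature criterion implies constant flag curvature. -/
lemma flagCurvature_eq (hA : IsMaurerCartanFrame br U A) (hφ : IsMinkowskiNorm φ)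
    (hF : ∀ x ∈ U, ∀ y, F x y = φ (A x y)) {x y : E n} (hx : x ∈ U) {κ : ℝ}
    (hK : ∀ i k, sprayCurvature F i k x y =
      κ * F x y ^ 2 * ((if i = k then 1 else 0) - y i / F x y * dy k F x y))
    {v : E n} (hyv : LinearIndependent ℝ ![y, v]) : flagCurvature F x y v = κ := by
  have hy : y ≠ 0 := by simpa using hyv.ne_zero 0
  have hw := hA.apply_ne_zero hx hy
  have hpos := hφ.pos _ hw
  set p := fderiv ℝ φ (A x y) (A x v) with hp
  have hT : ∀ j, ∑ k, sprayCurvature F j k x y * v k =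
      (κ • (φ (A x y) ^ 2 • v - (φ (A x y) * p) • y)) j := by
    intro j
    have h1 : ∑ k, v k * dy k F x y = p := by
      simp only [hA.dy_eq hφ hF hx hy]
      exact sum_mul_apply_single ((fderiv ℝ φ (A x y)).comp (A x)) v
    have h2 : ∀ k, sprayCurvature F j k x y * v k =
        κ * φ (A x y) ^ 2 * (if j = k then v k else 0)
          - κ * φ (A x y) * y j * (v k * dy k F x y) := by
      intro k
      rw [hK, hF x hx]
      split_ifs <;> field_simp
      ring
    simp only [h2, Finset.sum_sub_distrib, ← Finset.mul_sum, h1]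
    simp
    ring
  have hnum : ∑ i, ∑ k, v i * (∑ j, fundamentalTensor F i j x y * sprayCurvature F j k x y) * v k =
      fundamentalForm F x y v (κ • (φ (A x y) ^ 2 • v - (φ (A x y) * p) • y)) := by
    simp only [fundamentalForm, ← hT, Finset.mul_sum, Finset.sum_mul]
    refine Finset.sum_congr rfl fun i _ => ?_
    rw [Finset.sum_comm]
    exact Finset.sum_congr rfl fun j _ => Finset.sum_congr rfl fun k _ => by ring
  have e1 : minkowskiTensor φ (A x y) (A x y) (A x v) = φ (A x y) * p :=
    hφ.minkowskiTensor_self_left hw _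
  have e2 : minkowskiTensor φ (A x y) (A x v) (A x y) = φ (A x y) * p := by
    rw [hφ.minkowskiTensor_comm hw, e1]
  have e3 := hφ.minkowskiTensor_self_self hw
  have hne : φ (A x y) ^ 2 • v - (φ (A x y) * p) • y ≠ 0 := by
    intro h
    have := LinearIndependent.pair_iff.1 hyv (-(φ (A x y) * p)) (φ (A x y) ^ 2)
      (by rw [← h]; module)
    exact (pow_pos hpos 2).ne' this.2
  -- evaluating `g` on the part of `v` that is `g`-orthogonal to `y` shows that the area
  -- `g(y, y) g(v, v) - g(y, v)²` of the flag is positive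
  have hd := hφ.posDef _ hw _ (hA.apply_ne_zero hx hne)
  rw [flagCurvature, hnum]
  simp only [hA.fundamentalForm_eq hφ hF hx hy, pullbackTensor_apply, map_smul, map_sub,
    _root_.smul_apply, _root_.sub_apply, smul_eq_mul, e1, e2, e3] at hd ⊢
  have hd' : 0 < φ (A x y) ^ 2 * (φ (A x y) ^ 2 *
      minkowskiTensor φ (A x y) (A x v) (A x v) - (φ (A x y) * p) ^ 2) := by
    linarith
  have hpos2 := pos_of_mul_pos_right hd' (by positivity)
  rw [div_eq_iff hpos2.ne']
  ring

end

/-- The spray curvature criterion for the invariant Randers metric with norm `randersNorm s`. -/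
lemma sprayCurvature_randersNorm {U : Set (E 3)} {A : E 3 → E 3 →L[ℝ] E 3} {F : E 3 → E 3 → ℝ}
    (hA : IsMaurerCartanFrame imBracket U A) {s : ℝ}
    (hF : ∀ x ∈ U, ∀ y, F x y = randersNorm s (A x y))
    {x y : E 3} (hx : x ∈ U) (hy : y ≠ 0) (i k : Fin 3) :
    sprayCurvature F i k x y =
      (1 + s ^ 2) * F x y ^ 2 * ((if i = k then 1 else 0) - y i / F x y * dy k F x y) := by
  have hφ := isMinkowskiNorm_randersNorm s
  have hw := hA.apply_ne_zero hx hy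
  have hpos := hφ.pos _ hw
  have h := hA.apply_sprayCurvature_of_sprayCoeff_eq (contDiffOn_randersSpray s)
    (fun x hx y hy i => hA.sprayCoeff_eq hφ hF (minkowskiTensor_randersSpray s) hx hy i) hx hy k
  rw [invariantCurvature_randersSpray s hw, ← map_smul, ← map_smul, ← map_sub, ← map_smul] at h
  have h2 := congrArg (fun v : E 3 => v i) (hA.injective x hx h)
  simp only [PiLp.smul_apply, PiLp.sub_apply, smul_eq_mul, PiLp.single_apply] at h2
  rw [h2, hF x hx, hA.dy_eq hφ hF hx hy]
  field_simp

end IsMaurerCartanFrame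

/-! ### The Maurer–Cartan form of the unit quaternions -/

/-- The imaginary part of a quaternion, as a vector of `ℝ³`. -/
def imPart : ℍ[ℝ] →ₗ[ℝ] E 3 where
  toFun q := !₂[q.imI, q.imJ, q.imK]
  map_add' _ _ := by apply eq_of_forall_fin_three <;> simp
  map_smul' _ _ := by apply eq_of_forall_fin_three <;> simp

lemma eq_zero_of_imPart_eq_zero {q : ℍ[ℝ]} (hq : imPart q = 0) (hre : q.re = 0) : q = 0 := by
  have h := fun i : Fin 3 => congrArg (fun v : E 3 => v i) hq
  exact Quaternion.ext _ _ hre (h 0) (h 1) (h 2)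

lemma imBracket_imPart (p q : ℍ[ℝ]) : imBracket (imPart p) (imPart q) = imPart (p * q - q * p) := by
  apply eq_of_forall_fin_three <;> simp [imPart] <;> ring

/-- The right-invariant form `(x, v) ↦ Im (v x̄)` on `ℍ`, with components `Θ¹`, `Θ²`, `Θ³`. -/
def thetaForm : ℍ[ℝ] →L[ℝ] ℍ[ℝ] →L[ℝ] E 3 :=
  (LinearMap.mk₂ ℝ (fun x v : ℍ[ℝ] => imPart (v * star x))
    (fun _ _ _ => by rw [star_add, mul_add, map_add])
    (fun _ _ _ => by rw [Quaternion.star_smul, mul_smul_comm, map_smul])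
    (fun _ _ _ => by rw [add_mul, map_add])
    (fun _ _ _ => by rw [smul_mul_assoc, map_smul])).toContinuousBilinearMap

lemma thetaForm_apply (x v : ℍ[ℝ]) : thetaForm x v = imPart (v * star x) := rfl

/-- The matrix of the Maurer–Cartan form in a local parametrization `X` of the unit quaternions. -/
def quaternionFrame (X : E 3 → ℍ[ℝ]) (x : E 3) : E 3 →L[ℝ] E 3 := thetaForm (X x) ∘L fderiv ℝ X x

lemma mul_star_eq_neg_of_inner_eq_zero {a r : ℍ[ℝ]} (h : inner ℝ r a = 0) :
    a * star r = -(r * star a) := by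
  rw [real_inner_comm, Quaternion.inner_def] at h
  have := Quaternion.self_add_star (a * star r)
  rw [h] at this
  rw [eq_neg_iff_add_eq_zero]
  simpa using this

lemma star_mul_eq_neg_of_inner_eq_zero {a r : ℍ[ℝ]} (h : inner ℝ r a = 0) :
    star r * a = -(star a * r) := by
  have h2 : (star r * a).re = inner ℝ r a := by
    rw [Quaternion.inner_def]
    simp
  have := Quaternion.self_add_star (star r * a)
  rw [h2, h] at this
  rw [eq_neg_iff_add_eq_zero]
  simpa using this

/-- The Maurer–Cartan equation at the level of quaternions: `a` and `b` are tangent to the sphere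
at `r`. -/
lemma thetaForm_sub_thetaForm {a b r : ℍ[ℝ]} (hr : ‖r‖ = 1) (ha : inner ℝ r a = 0)
    (hb : inner ℝ r b = 0) :
    thetaForm a b - thetaForm b a = imBracket (thetaForm r a) (thetaForm r b) := by
  have hr1 : r * star r = 1 := by
    rw [Quaternion.self_mul_star, Quaternion.normSq_eq_norm_mul_self, hr]; simp
  have hr2 : star r * r = 1 := by
    rw [Quaternion.star_mul_self, Quaternion.normSq_eq_norm_mul_self, hr]; simp
  simp only [thetaForm_apply, imBracket_imPart, ← map_sub]
  congr 1
  have h1 : a * star r * (b * star r) = -(a * star b) := by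
    rw [mul_star_eq_neg_of_inner_eq_zero hb, mul_neg, mul_assoc, ← mul_assoc (star r), hr2, one_mul]
  have h2 : b * star r * (a * star r) = -(b * star a) := by
    rw [mul_assoc, ← mul_assoc (star r), star_mul_eq_neg_of_inner_eq_zero ha, neg_mul, mul_neg,
      mul_assoc, hr1, mul_one]
  rw [h1, h2]
  abel

lemma eq_zero_of_thetaForm_eq_zero {a r : ℍ[ℝ]} (hr : ‖r‖ = 1) (ha : inner ℝ r a = 0)
    (h : thetaForm r a = 0) : a = 0 := by
  rw [real_inner_comm, Quaternion.inner_def] at ha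
  have hr2 : star r * r = 1 := by
    rw [Quaternion.star_mul_self, Quaternion.normSq_eq_norm_mul_self, hr]; simp
  rw [← mul_one a, ← hr2, ← mul_assoc, eq_zero_of_imPart_eq_zero h ha, zero_mul]

/-- The coordinates of a right-invariant coframe in a local parametrization `X` of the unit
quaternions form a Maurer–Cartan frame. -/
lemma isMaurerCartanFrame_quaternionFrame {X : E 3 → ℍ[ℝ]} {U : Set (E 3)} (hU : IsOpen U)
    (hX : ContDiffOn ℝ ∞ X U) (hX1 : ∀ x ∈ U, ‖X x‖ = 1)
    (hXi : ∀ x ∈ U, Function.Injective (fderiv ℝ X x)) :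
    IsMaurerCartanFrame imBracket U (quaternionFrame X) := by
  have hs : ∀ x ∈ U, ContDiffAt ℝ ∞ X x := fun x hx => hX.contDiffAt (hU.mem_nhds hx)
  have hs1 : ∀ x ∈ U, ContDiffAt ℝ ∞ (fderiv ℝ X) x := fun x hx =>
    (hs x hx).fderiv_right (by simp)
  have hd : ∀ x ∈ U, HasFDerivAt X (fderiv ℝ X x) x := fun x hx =>
    ((hs x hx).differentiableAt (by simp)).hasFDerivAt
  have hd1 : ∀ x ∈ U, HasFDerivAt (fderiv ℝ X) (fderiv ℝ (fderiv ℝ X) x) x := fun x hx =>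
    ((hs1 x hx).differentiableAt (by simp)).hasFDerivAt
  have horth : ∀ x ∈ U, ∀ y, inner ℝ (X x) (fderiv ℝ X x y) = 0 := by
    intro x hx y
    have h1 := (hd x hx).norm_sq
    have h2 := (hasFDerivAt_const (𝕜 := ℝ) (1 : ℝ) x).congr_of_eventuallyEq
      (f₁ := fun x => ‖X x‖ ^ 2)
      (by filter_upwards [hU.mem_nhds hx] with x' hx'; rw [hX1 x' hx']; norm_num)
    have := congrArg (fun T : E 3 →L[ℝ] ℝ => T y) (h1.unique h2)
    simpa using this
  refine ⟨hU, fun x hx => ?_, fun x hx => ?_, fun x hx y z => ?_⟩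
  · exact ((thetaForm.contDiff.contDiffAt.comp x (hs x hx)).clm_comp (hs1 x hx)).contDiffWithinAt
  · rw [injective_iff_map_eq_zero]
    intro y hy
    apply (injective_iff_map_eq_zero _).1 (hXi x hx)
    exact eq_zero_of_thetaForm_eq_zero (hX1 x hx) (horth x hx y) hy
  · have h : HasFDerivAt (quaternionFrame X) _ x :=
      (thetaForm.hasFDerivAt.comp x (hd x hx)).clm_comp (hd1 x hx)
    have hsymm := (hs x hx).isSymmSndFDerivAt
      (by simp; exact WithTop.coe_le_coe.2 le_top) y z
    rw [h.fderiv]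
    simp only [quaternionFrame, ContinuousLinearMap.comp_apply, _root_.add_apply,
      ContinuousLinearMap.compL_apply, ContinuousLinearMap.flip_apply, hsymm]
    rw [← thetaForm_sub_thetaForm (hX1 x hx) (horth x hx y) (horth x hx z)]
    abel

/-! ### The right-invariant coframe on the manifold `S³` -/

lemma contMDiff_coe_S3 : ContMDiff (𝓡 3) 𝓘(ℝ, ℍ[ℝ]) ∞ (fun z : S3 => (z : ℍ[ℝ])) :=
  contMDiff_coe_sphere

lemma mdifferentiableAt_coe_S3 (x : S3) :
    MDifferentiableAt (𝓡 3) 𝓘(ℝ, ℍ[ℝ]) (fun z : S3 => (z : ℍ[ℝ])) x :=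
  contMDiff_coe_S3.mdifferentiableAt (by simp)

/-- The linear map underlying `ambient`. -/
def ambientL (x : S3) : TangentSpace (𝓡 3) x →L[ℝ] ℍ[ℝ] :=
  mfderiv (𝓡 3) 𝓘(ℝ, ℍ[ℝ]) (fun z : S3 => (z : ℍ[ℝ])) x

lemma ambientL_eq_mvfderiv (x : S3) :
    ambientL x = mvfderiv (𝓡 3) (fun z : S3 => (z : ℍ[ℝ])) x :=
  rfl

lemma ambientL_injective (x : S3) : Function.Injective (ambientL x) := by
  rw [ambientL_eq_mvfderiv]
  exact injective_mvfderiv_subtypeVal_sphere x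

lemma inner_ambientL (x : S3) (v : TangentSpace (𝓡 3) x) :
    inner ℝ (x : ℍ[ℝ]) (ambientL x v) = 0 := by
  have h : ambientL x v ∈ (ambientL x).range := ⟨v, rfl⟩
  rw [ambientL_eq_mvfderiv] at h ⊢
  have h2 := range_mvfderiv_subtypeVal (n := 3) x
  rw [h2] at h
  exact Submodule.mem_orthogonal_singleton_iff_inner_right.1 h

lemma norm_coe_S3 (x : S3) : ‖(x : ℍ[ℝ])‖ = 1 := by simp

/-- The coframe `(Θ¹, Θ², Θ³)` at `x`, as a linear map to `ℝ³`. -/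
def coframe (x : S3) : TangentSpace (𝓡 3) x →L[ℝ] E 3 := thetaForm (x : ℍ[ℝ]) ∘L ambientL x

lemma theta1_eq (x : S3) (v : TangentSpace (𝓡 3) x) : theta1 x v = coframe x v 0 := by
  change _ = ((ambient x v) * star (x : ℍ[ℝ])).imI
  simp [theta1]
  ring

lemma theta2_eq (x : S3) (v : TangentSpace (𝓡 3) x) : theta2 x v = coframe x v 1 := by
  change _ = ((ambient x v) * star (x : ℍ[ℝ])).imJ
  simp [theta2]
  ring

lemma theta3_eq (x : S3) (v : TangentSpace (𝓡 3) x) : theta3 x v = coframe x v 2 := by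
  change _ = ((ambient x v) * star (x : ℍ[ℝ])).imK
  simp [theta3]
  ring

lemma coframe_injective (x : S3) : Function.Injective (coframe x) := by
  rw [injective_iff_map_eq_zero]
  intro v hv
  apply (injective_iff_map_eq_zero _).1 (ambientL_injective x)
  exact eq_zero_of_thetaForm_eq_zero (norm_coe_S3 x) (inner_ambientL x v) hv

lemma coframe_ne_zero {x : S3} {v : TangentSpace (𝓡 3) x} (hv : v ≠ 0) : coframe x v ≠ 0 :=
  fun h => hv (coframe_injective x (h.trans (map_zero _).symm))

/-- The coframe as a linear isomorphism of the tangent space with `ℝ³`. -/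
def coframeEquiv (x : S3) : TangentSpace (𝓡 3) x ≃L[ℝ] E 3 :=
  let T : E 3 →L[ℝ] E 3 := coframe x
  let S : E 3 ≃L[ℝ] E 3 :=
    (LinearEquiv.ofInjectiveEndo T.toLinearMap (coframe_injective x)).toContinuousLinearEquiv
  S

/-! ### Invariant metrics in the charts of `S³` -/

lemma aTilde_eq (K : ℝ) (x : S3) (v w : TangentSpace (𝓡 3) x) :
    aTilde K x v w = K * (coframe x v 0 * coframe x w 0) + coframe x v 1 * coframe x w 1
      + coframe x v 2 * coframe x w 2 := by
  rw [aTilde, theta1_eq, theta1_eq, theta2_eq, theta2_eq, theta3_eq, theta3_eq]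

lemma one_add_sq_mul_sqrt {K σ : ℝ} (hK : 1 < K) (hσ : σ = 1 ∨ σ = -1) :
    1 + (σ * Real.sqrt (K - 1)) ^ 2 = K := by
  rw [mul_pow, Real.sq_sqrt (by linarith)]
  rcases hσ with rfl | rfl <;> ring

lemma randers_eq {K σ : ℝ} (hK : 1 < K) (hσ : σ = 1 ∨ σ = -1) (x : S3)
    (v : TangentSpace (𝓡 3) x) :
    randers (aTilde K) (bTilde K σ) x v = randersNorm (σ * Real.sqrt (K - 1)) (coframe x v) := by
  rw [randers, aTilde_eq, bTilde, theta1_eq, randersNorm, one_add_sq_mul_sqrt hK hσ]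
  ring_nf

lemma mdifferentiable_of_mem_maximalAtlas {e : OpenPartialHomeomorph S3 (E 3)}
    (he : e ∈ IsManifold.maximalAtlas (𝓡 3) ∞ S3) : e.MDifferentiable (𝓡 3) (𝓡 3) :=
  ⟨(contMDiffOn_of_mem_maximalAtlas he).mdifferentiableOn (by simp),
    (contMDiffOn_symm_of_mem_maximalAtlas he).mdifferentiableOn (by simp)⟩

/-- The inverse of a chart, as a parametrization of the sphere in the ambient space. -/
def parametrization (e : OpenPartialHomeomorph S3 (E 3)) (x : E 3) : ℍ[ℝ] := e.symm x

section Chart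

variable {e : OpenPartialHomeomorph S3 (E 3)} (he : e ∈ IsManifold.maximalAtlas (𝓡 3) ∞ S3)
include he

lemma ambientL_mfderiv_symm {x : E 3} (hx : x ∈ e.target) (y : E 3) :
    ambientL (e.symm x) (mfderiv (𝓡 3) (𝓡 3) e.symm x y) = fderiv ℝ (parametrization e) x y := by
  have h := mfderiv_comp x (mdifferentiableAt_coe_S3 (e.symm x))
    ((mdifferentiable_of_mem_maximalAtlas he).mdifferentiableAt_symm hx)
  rw [← mfderiv_eq_fderiv]
  exact (congrArg (fun T : E 3 →L[ℝ] ℍ[ℝ] => T y) h).symm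

/-- In a chart the coframe is the Maurer–Cartan matrix of the inverse chart. -/
lemma coframe_mfderiv_symm {x : E 3} (hx : x ∈ e.target) (y : E 3) :
    coframe (e.symm x) (mfderiv (𝓡 3) (𝓡 3) e.symm x y) =
      quaternionFrame (parametrization e) x y :=
  congrArg (thetaForm (e.symm x : ℍ[ℝ])) (ambientL_mfderiv_symm he hx y)

lemma isMaurerCartanFrame_chart :
    IsMaurerCartanFrame imBracket e.target (quaternionFrame (parametrization e)) := by
  refine isMaurerCartanFrame_quaternionFrame e.open_target ?_ (fun x _ => norm_coe_S3 _)
    fun x hx => ?_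
  · rw [← contMDiffOn_iff_contDiffOn]
    exact contMDiff_coe_S3.comp_contMDiffOn (contMDiffOn_symm_of_mem_maximalAtlas he)
  · intro y z hyz
    rw [← ambientL_mfderiv_symm he hx, ← ambientL_mfderiv_symm he hx] at hyz
    exact (mdifferentiable_of_mem_maximalAtlas he).symm.mfderiv_injective hx
      (ambientL_injective _ hyz)

end Chart

/-! ### Smoothness and right invariance of the coframe -/

lemma contMDiff_thetaForm :
    ContMDiff 𝓘(ℝ, ℍ[ℝ]) 𝓘(ℝ, ℍ[ℝ] →L[ℝ] E 3) ∞ (fun q : ℍ[ℝ] => thetaForm q) :=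
  contMDiff_iff_contDiff.2 (by fun_prop)

lemma contMDiff_coframe : ContMDiff (𝓡 3).tangent 𝓘(ℝ, E 3) ∞
    (fun v : TangentBundle (𝓡 3) S3 => coframe v.proj v.snd) := by
  have h1 : ContMDiff (𝓡 3).tangent 𝓘(ℝ, ℍ[ℝ]) ∞
      (fun v : TangentBundle (𝓡 3) S3 => ambientL v.proj v.snd) :=
    (contMDiff_snd_tangentBundle_modelSpace ℍ[ℝ] 𝓘(ℝ, ℍ[ℝ])).comp
      (contMDiff_coe_S3.contMDiff_tangentMap (m := ∞) (by simp))
  have h2 : ContMDiff (𝓡 3).tangent 𝓘(ℝ, ℍ[ℝ]) ∞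
      (fun v : TangentBundle (𝓡 3) S3 => (v.proj : ℍ[ℝ])) :=
    contMDiff_coe_S3.comp (Bundle.contMDiff_proj _)
  have h3 : ContMDiff (𝓡 3).tangent 𝓘(ℝ, ℍ[ℝ] →L[ℝ] E 3) ∞
      (fun v : TangentBundle (𝓡 3) S3 => thetaForm (v.proj : ℍ[ℝ])) :=
    contMDiff_thetaForm.comp h2
  exact h3.clm_apply h1

lemma contMDiff_mul_right_S3 (g : S3) :
    ContMDiff (𝓡 3) (𝓡 3) ∞ (fun z : S3 => z * g) := by
  apply ContMDiff.codRestrict_sphere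
  have h : ContDiff ℝ ∞ fun q : ℍ[ℝ] => q * (g : ℍ[ℝ]) := by fun_prop
  exact h.contMDiff.comp contMDiff_coe_S3

/-- The coframe is right-invariant, because `v g` times the conjugate of `x g` is `v x̄` for a
unit quaternion `g`. -/
lemma coframe_mul_right (g x : S3) (v : TangentSpace (𝓡 3) x) :
    coframe (x * g) (mfderiv (𝓡 3) (𝓡 3) (fun z : S3 => z * g) x v) = coframe x v := by
  have h1 := mfderiv_comp x (mdifferentiableAt_coe_S3 (x * g))
    ((contMDiff_mul_right_S3 g).mdifferentiableAt (x := x) (by simp))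
  have h2 := mfderiv_comp x (I' := 𝓘(ℝ, ℍ[ℝ])) (g := fun q : ℍ[ℝ] => q * (g : ℍ[ℝ]))
    (DifferentiableAt.mdifferentiableAt (by fun_prop)) (mdifferentiableAt_coe_S3 x)
  have h3 : ambientL (x * g) (mfderiv (𝓡 3) (𝓡 3) (fun z : S3 => z * g) x v) =
      ambientL x v * (g : ℍ[ℝ]) := by
    have h4 : fderiv ℝ (fun q : ℍ[ℝ] => q * (g : ℍ[ℝ])) x =
        (ContinuousLinearMap.mul ℝ ℍ[ℝ]).flip (g : ℍ[ℝ]) :=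
      ((ContinuousLinearMap.mul ℝ ℍ[ℝ]).flip (g : ℍ[ℝ])).fderiv
    rw [mfderiv_eq_fderiv, h4] at h2
    exact congrArg (fun T : E 3 →L[ℝ] ℍ[ℝ] => T v) (h1.symm.trans h2)
  change thetaForm ((x * g : S3) : ℍ[ℝ]) (ambientL (x * g) _) = thetaForm (x : ℍ[ℝ]) (ambientL x v)
  rw [h3, thetaForm_apply, thetaForm_apply]
  congr 1
  have hg : (g : ℍ[ℝ]) * star (g : ℍ[ℝ]) = 1 := by
    rw [Quaternion.self_mul_star, Quaternion.normSq_eq_norm_mul_self, norm_coe_S3]; simp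
  rw [Metric.unitSphere.coe_mul, star_mul, mul_assoc, ← mul_assoc (g : ℍ[ℝ]), hg, one_mul]

/-! ### The Riemannian metric -/

/-- The inner product `K u₀ v₀ + u₁ v₁ + u₂ v₂` on `ℝ³`. -/
def modelForm (K : ℝ) : E 3 →L[ℝ] E 3 →L[ℝ] ℝ :=
  (LinearMap.mk₂ ℝ (fun u v : E 3 => K * (u 0 * v 0) + u 1 * v 1 + u 2 * v 2)
    (fun _ _ _ => by simp; ring) (fun _ _ _ => by simp; ring) (fun _ _ _ => by simp; ring)
    (fun _ _ _ => by simp; ring)).toContinuousBilinearMap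

/-- The pullback of `modelForm K` by a linear map. -/
def modelPullback (K : ℝ) (T : E 3 →L[ℝ] E 3) : E 3 →L[ℝ] E 3 →L[ℝ] ℝ :=
  (ContinuousLinearMap.compL ℝ (E 3) (E 3) ℝ).flip T ∘L (modelForm K ∘L T)

lemma modelPullback_apply (K : ℝ) (T : E 3 →L[ℝ] E 3) (u v : E 3) :
    modelPullback K T u v = modelForm K (T u) (T v) := rfl

lemma contDiff_modelPullback (K : ℝ) : ContDiff ℝ ∞ (modelPullback K) := by
  unfold modelPullback
  fun_prop

/-- The form `ã` at `x`, as a continuous bilinear map. -/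
def metricForm (K : ℝ) (x : S3) : TangentSpace (𝓡 3) x →L[ℝ] TangentSpace (𝓡 3) x →L[ℝ] ℝ :=
  modelPullback K (coframe x)

lemma metricForm_apply (K : ℝ) (x : S3) (v w : TangentSpace (𝓡 3) x) :
    metricForm K x v w = aTilde K x v w :=
  (aTilde_eq K x v w).symm

/-- The coframe in the trivialization of the tangent bundle at `x₀`. -/
def coframeCoord (x₀ x : S3) : E 3 →L[ℝ] E 3 :=
  thetaForm (x : ℍ[ℝ]) ∘L inTangentCoordinates (𝓡 3) 𝓘(ℝ, ℍ[ℝ]) id (fun z : S3 => (z : ℍ[ℝ]))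
    (mfderiv (𝓡 3) 𝓘(ℝ, ℍ[ℝ]) (fun z : S3 => (z : ℍ[ℝ]))) x₀ x

lemma contMDiffAt_coframeCoord (x₀ : S3) :
    ContMDiffAt (𝓡 3) 𝓘(ℝ, E 3 →L[ℝ] E 3) ∞ (coframeCoord x₀) x₀ :=
  ((contMDiff_thetaForm.comp contMDiff_coe_S3).contMDiffAt).clm_comp
    (contMDiff_coe_S3.contMDiffAt.mfderiv_const (by simp))

lemma coframeCoord_apply {x₀ x : S3}
    (hx : x ∈ (trivializationAt (E 3) (TangentSpace (𝓡 3) : S3 → Type) x₀).baseSet) (v : E 3) :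
    coframeCoord x₀ x v = coframe x
      ((trivializationAt (E 3) (TangentSpace (𝓡 3) : S3 → Type) x₀).symm x v) := by
  have h : inTangentCoordinates (𝓡 3) 𝓘(ℝ, ℍ[ℝ]) id (fun z : S3 => (z : ℍ[ℝ]))
      (mfderiv (𝓡 3) 𝓘(ℝ, ℍ[ℝ]) (fun z : S3 => (z : ℍ[ℝ]))) x₀ x v =
      ambientL x ((trivializationAt (E 3) (TangentSpace (𝓡 3) : S3 → Type) x₀).symm x v) := by
    change ContinuousLinearMap.inCoordinates (E 3) (TangentSpace (𝓡 3) : S3 → Type) ℍ[ℝ]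
      (TangentSpace 𝓘(ℝ, ℍ[ℝ]) : ℍ[ℝ] → Type) x₀ x (x₀ : ℍ[ℝ]) (x : ℍ[ℝ])
      (mfderiv (𝓡 3) 𝓘(ℝ, ℍ[ℝ]) (fun z : S3 => (z : ℍ[ℝ])) x) v = _
    rw [ContinuousLinearMap.inCoordinates_eq hx
      (by rw [TangentBundle.trivializationAt_baseSet]; exact Set.mem_univ _)]
    simp
    rfl
  exact congrArg (thetaForm (x : ℍ[ℝ])) h

lemma contMDiff_metricForm (K : ℝ) : ContMDiff (𝓡 3) ((𝓡 3).prod 𝓘(ℝ, E 3 →L[ℝ] E 3 →L[ℝ] ℝ)) ∞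
    (fun x : S3 => Bundle.TotalSpace.mk' (E 3 →L[ℝ] E 3 →L[ℝ] ℝ)
      (E := fun x : S3 => TangentSpace (𝓡 3) x →L[ℝ] TangentSpace (𝓡 3) x →L[ℝ] ℝ)
      x (metricForm K x)) := by
  intro x₀
  rw [contMDiffAt_hom_bundle]
  refine ⟨contMDiffAt_id, ?_⟩
  have h : ContMDiffAt (𝓡 3) 𝓘(ℝ, E 3 →L[ℝ] E 3 →L[ℝ] ℝ) ∞
      (fun x => modelPullback K (coframeCoord x₀ x)) x₀ :=
    (contMDiff_iff_contDiff.2 (contDiff_modelPullback K)).contMDiffAt.comp x₀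
      (contMDiffAt_coframeCoord x₀)
  refine h.congr_of_eventuallyEq ?_
  filter_upwards [(trivializationAt (E 3) (TangentSpace (𝓡 3) : S3 → Type) x₀).open_baseSet.mem_nhds
    (FiberBundle.mem_baseSet_trivializationAt' x₀)] with x hx
  ext v w
  rw [modelPullback_apply, coframeCoord_apply hx, coframeCoord_apply hx,
    inCoordinates_apply_eq₂ hx hx (Set.mem_univ _)]
  simp only [Bundle.Trivial.fiberBundle_trivializationAt',
    Bundle.Trivial.linearMapAt_trivialization]
  rfl

lemma isRiemannianMetric_aTilde {K : ℝ} (hK : 1 < K) : IsRiemannianMetric (aTilde K) := by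
  refine ⟨{ inner := metricForm K
            symm := fun x v w => ?_
            pos := fun x v hv => ?_
            isVonNBounded := fun x => ?_
            contMDiff := contMDiff_metricForm K }, metricForm_apply K⟩
  · rw [metricForm_apply, metricForm_apply, aTilde_eq, aTilde_eq]
    ring
  · have h := quadratic_pos 0 (coframe_ne_zero hv)
    rw [metricForm_apply, aTilde_eq]
    nlinarith [sq_nonneg (coframe x v 0)]
  -- as `K > 1`, the unit ball of `ã` lies in the preimage of the Euclidean unit ball
  · refine ((NormedSpace.isVonNBounded_ball ℝ (E 3) 1).image
      ((coframeEquiv x).symm : E 3 →L[ℝ] TangentSpace (𝓡 3) x)).subset fun v hv => ?_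
    refine ⟨coframe x v, ?_, (coframeEquiv x).symm_apply_apply v⟩
    rw [mem_ball_zero_iff]
    have h1 : ‖coframe x v‖ ^ 2 < 1 := by
      have h2 : aTilde K x v v < 1 := by rw [← metricForm_apply]; exact hv
      rw [aTilde_eq] at h2
      rw [EuclideanSpace.norm_sq_eq, Fin.sum_univ_three]
      simp only [Real.norm_eq_abs, sq_abs]
      nlinarith [sq_nonneg (coframe x v 0)]
    nlinarith [norm_nonneg (coframe x v)]

/-! ### The one-form, and the Randers metric -/

lemma contMDiff_coord {N : Type*} [TopologicalSpace N] {H E' : Type*} [NormedAddCommGroup E']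
    [NormedSpace ℝ E'] [TopologicalSpace H] {I : ModelWithCorners ℝ E' H} [ChartedSpace H N]
    {f : N → E 3} (hf : ContMDiff I 𝓘(ℝ, E 3) ∞ f) (i : Fin 3) :
    ContMDiff I 𝓘(ℝ, ℝ) ∞ (fun p => f p i) := by
  have h : ContDiff ℝ ∞ fun w : E 3 => w i := by fun_prop
  exact h.contMDiff.comp hf

lemma isSmoothOneForm_bTilde (K σ : ℝ) : IsSmoothOneForm (bTilde K σ) where
  linear x := by
    constructor
    · intro v w
      simp only [bTilde, theta1_eq, map_add, PiLp.add_apply]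
      ring
    · intro c v
      simp only [bTilde, theta1_eq, map_smul, PiLp.smul_apply, smul_eq_mul]
      ring
  smooth := by
    simp only [bTilde, theta1_eq]
    exact contMDiff_const.mul (contMDiff_coord contMDiff_coframe 0)

/-- If `b = a(X, ·)`, the norm of the covector `b` is `√b(X)`. -/
lemma covectorNorm_eq_of_dual {n : ℕ} {V : Type*} [AddCommGroup V] [Module ℝ V]
    (a : V →ₗ[ℝ] V →ₗ[ℝ] ℝ) (hsymm : ∀ v w, a v w = a w v) (hpos : ∀ v, v ≠ 0 → 0 < a v v)
    {b : V → ℝ} {X : V} (hX : ∀ v, b v = a X v) (B : Module.Basis (Fin n) ℝ V) :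
    covectorNorm (fun v w => a v w) b B = Real.sqrt (b X) := by
  set g : Matrix (Fin n) (Fin n) ℝ := Matrix.of fun k l => a (B k) (B l) with hg
  have hgc : ∀ c : Fin n → ℝ, ∀ k, g.mulVec c k = a (B k) (∑ l, c l • B l) := by
    intro c k
    simp [Matrix.mulVec, dotProduct, hg, mul_comm]
  have hdet : IsUnit g.det := by
    rw [isUnit_iff_ne_zero]
    intro h0
    obtain ⟨c, hc, hgc0⟩ := Matrix.exists_mulVec_eq_zero_iff.2 h0
    have hv : ∑ l, c l • B l ≠ 0 := by
      intro h
      exact hc (funext fun l => (Fintype.linearIndependent_iff.1 B.linearIndependent) c h l)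
    have hz : a (∑ l, c l • B l) (∑ l, c l • B l) = 0 := by
      have : ∀ k, a (∑ l, c l • B l) (B k) = 0 := fun k => by rw [hsymm, ← hgc, hgc0]; rfl
      rw [map_sum]
      simp only [map_smul, this, smul_zero, Finset.sum_const_zero]
    exact (hpos _ hv).ne' hz
  have hb : (fun k => b (B k)) = g.mulVec (B.repr X) := by
    funext k
    rw [hgc, B.sum_repr, hX, hsymm]
  have hc : g⁻¹.mulVec (fun k => b (B k)) = B.repr X := by
    rw [hb, Matrix.mulVec_mulVec, Matrix.nonsing_inv_mul _ hdet, Matrix.one_mulVec]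
  have hbX : b X = ∑ i, B.repr X i * b (B i) := by
    have h := congrArg (a X) (B.sum_repr X)
    rw [hX, ← h, map_sum]
    simp [hX]
  rw [covectorNorm, hbX, ← hc]
  congr 1
  refine Finset.sum_congr rfl fun i _ => ?_
  rw [Matrix.mulVec, dotProduct, Finset.sum_mul]
  exact Finset.sum_congr rfl fun j _ => mul_right_comm _ _ _

lemma covectorNorm_bTilde {K σ : ℝ} (hK : 1 < K) (hσ : σ = 1 ∨ σ = -1) (x : S3)
    (B : Module.Basis (Fin 3) ℝ (TangentSpace (𝓡 3) x)) :
    covectorNorm (aTilde K x) (bTilde K σ x) B = Real.sqrt (1 - 1 / K) := by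
  obtain ⟨s, hs⟩ : ∃ s, s = σ * Real.sqrt (K - 1) := ⟨_, rfl⟩
  have hsK := one_add_sq_mul_sqrt hK hσ
  rw [← hs] at hsK
  have hK0 : K ≠ 0 := by linarith
  -- the vector with `Θ¹ = s / K`, `Θ² = Θ³ = 0` is dual to `b̃`
  have hX : coframe x ((coframeEquiv x).symm (EuclideanSpace.single 0 (s / K))) =
      EuclideanSpace.single 0 (s / K) := (coframeEquiv x).apply_symm_apply _
  have h := covectorNorm_eq_of_dual (V := TangentSpace (𝓡 3) x)
    (LinearMap.mk₂ ℝ (aTilde K x) (fun u v w => by simp [← metricForm_apply])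
      (fun c v w => by simp [← metricForm_apply]) (fun u v w => by simp [← metricForm_apply])
      (fun c v w => by simp [← metricForm_apply]))
    (fun v w => by simp only [LinearMap.mk₂_apply, aTilde_eq]; ring)
    (fun v hv => by
      rw [LinearMap.mk₂_apply, aTilde_eq]
      nlinarith [sq_nonneg (coframe x v 0), quadratic_pos 0 (coframe_ne_zero hv)])
    (b := bTilde K σ x) (X := (coframeEquiv x).symm (EuclideanSpace.single 0 (s / K)))
    (fun v => by
      rw [LinearMap.mk₂_apply, aTilde_eq, hX, bTilde, theta1_eq, ← hs]
      simp
      field_simp) B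
  refine h.trans ?_
  rw [bTilde, theta1_eq, hX, ← hs, PiLp.single_apply]
  congr 1
  simp
  field_simp
  linear_combination hsK

lemma inChart_randers_eq {K σ : ℝ} (hK : 1 < K) (hσ : σ = 1 ∨ σ = -1)
    {e : OpenPartialHomeomorph S3 (E 3)} (he : e ∈ IsManifold.maximalAtlas (𝓡 3) ∞ S3)
    (x : E 3) (hx : x ∈ e.target) (y : E 3) :
    inChart (randers (aTilde K) (bTilde K σ)) e x y =
      randersNorm (σ * Real.sqrt (K - 1)) (quaternionFrame (parametrization e) x y) := by
  rw [inChart, randers_eq hK hσ, coframe_mfderiv_symm he hx]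

lemma isYGlobalFinslerMetric_randers {K σ : ℝ} (hK : 1 < K) (hσ : σ = 1 ∨ σ = -1) :
    IsYGlobalFinslerMetric (randers (aTilde K) (bTilde K σ)) where
  smooth := by
    intro v hv
    simp only [randers_eq hK hσ]
    exact ((contDiffAt_randersNorm _ (coframe_ne_zero hv)).contMDiffAt.comp v
      contMDiff_coframe.contMDiffAt).contMDiffWithinAt
  pos x v hv := by
    rw [randers_eq hK hσ]
    exact randersNorm_pos _ (coframe_ne_zero hv)
  homogeneous x c v hc := by
    rw [randers_eq hK hσ, randers_eq hK hσ, map_smul]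
    exact (isMinkowskiNorm_randersNorm _).homogeneous c hc _
  stronglyConvex e he x hx y hy :=
    (isMaurerCartanFrame_chart he).posDef_fundamentalMatrix (isMinkowskiNorm_randersNorm _)
      (inChart_randers_eq hK hσ he) hx hy

lemma satisfiesSprayCriterion_randers {K σ : ℝ} (hK : 1 < K) (hσ : σ = 1 ∨ σ = -1) :
    SatisfiesSprayCriterion (randers (aTilde K) (bTilde K σ)) K := by
  intro e he x hx y hy i k
  have h := (isMaurerCartanFrame_chart he).sprayCurvature_randersNorm
    (inChart_randers_eq hK hσ he) hx hy i k
  rwa [one_add_sq_mul_sqrt hK hσ] at h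

lemma hasConstantFlagCurvature_randers {K σ : ℝ} (hK : 1 < K) (hσ : σ = 1 ∨ σ = -1) :
    HasConstantFlagCurvature (randers (aTilde K) (bTilde K σ)) K := fun e he x hx y _ hyv =>
  (isMaurerCartanFrame_chart he).flagCurvature_eq (isMinkowskiNorm_randersNorm _)
    (inChart_randers_eq hK hσ he) hx
    (satisfiesSprayCriterion_randers hK hσ e he x hx y (by simpa using hyv.ne_zero 0)) hyv

end Finsler

end

theorem mainTheorem1 (K : ℝ) (hK : 1 < K) (σ : ℝ) (hσ : σ = 1 ∨ σ = -1) :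
    Finsler.IsRiemannianMetric (Finsler.aTilde K) ∧
    Finsler.IsRightInvariant (Finsler.aTilde K) ∧
    Finsler.IsSmoothOneForm (Finsler.bTilde K σ) ∧
    (∀ (x : Finsler.S3) (B : Module.Basis (Fin 3) ℝ (TangentSpace (𝓡 3) x)),
      Finsler.covectorNorm (Finsler.aTilde K x) (Finsler.bTilde K σ x) B
        = Real.sqrt (1 - 1 / K)) ∧
    Real.sqrt (1 - 1 / K) < 1 ∧
    Finsler.IsYGlobalFinslerMetric (Finsler.randers (Finsler.aTilde K) (Finsler.bTilde K σ)) ∧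
    Finsler.SatisfiesSprayCriterion (Finsler.randers (Finsler.aTilde K) (Finsler.bTilde K σ)) K ∧
    Finsler.HasConstantFlagCurvature
      (Finsler.randers (Finsler.aTilde K) (Finsler.bTilde K σ)) K := by
  refine ⟨Finsler.isRiemannianMetric_aTilde hK, fun g x v w => ?_,
    Finsler.isSmoothOneForm_bTilde K σ, Finsler.covectorNorm_bTilde hK hσ, ?_,
    Finsler.isYGlobalFinslerMetric_randers hK hσ, Finsler.satisfiesSprayCriterion_randers hK hσ,
    Finsler.hasConstantFlagCurvature_randers hK hσ⟩
  · simp only [Finsler.aTilde_eq, Finsler.coframe_mul_right]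
  · rw [Real.sqrt_lt' one_pos]
    have : 0 < 1 / K := by positivity
    linarith
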